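/- \textbf{Setting.} There are $N$ items with known revenues $r_i\in[0,1]$, a known penalty $c\in[0,1]$, unknown selection probabilities $u_i\in[0,1]$ and an unknown $q\in[0,1]$. In each round $t=1,2,\dots,T$ a new user is shown a finite (possibly empty) sequence $S=(S_1,\dots,S_m)$ of distinct items, one after another. A viewed item $i$ is selected with probability $u_i$, and the user then leaves; after each viewed item that is not selected the user abandons the platform with probability $1-q$ (patience geometric, $P(W>k)=q^k$), and otherwise views the next item, if there is one. All these events are independent. A selection of $i$ pays $r_i$, an abandonment costs $c$, so that the expected payoff of $S$ is $$\mathbb E[U(S;u,q)]=\sum_{k=1}^m q^{k-1}\prod_{j<k}(1-u_{S_j})\,u_{S_k}r_{S_k}-c\sum_{k=1}^m q^{k-1}(1-q)\prod_{j\le k}(1-u_{S_j}).$$ \textbf{The algorithm SBORS} has parameters $\alpha>0$, $\beta\ge2$ and an integer $R\ge1$. It keeps counters, all started at $1$: $c_i$ and $f_i$ (views of item $i$ with and without selection), $n_e$ and $n_a$ (unselected views without and with abandonment). For a pair $(a,b)$ of counters put $\hat m=\frac{a}{a+b}$ and $\hat\sigma=\sqrt{\frac{\alpha\hat m(1-\hat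 m)}{a+b+1}}+\sqrt{\frac{\beta}{a+b}}$; the pairs $(c_i,f_i)$ give $\hat u_i,\hat\sigma_{u_i}$ and $(n_e,n_a)$ gives $\hat q,\hat\sigma_q$. In round $t$ it draws fresh independent $\theta^{(1)},\dots,\theta^{(R)}\sim N(0,1)$, forms $u_i'=\max_{j\le R}(\hat u_i+\theta^{(j)}\hat\sigma_{u_i})$ and $q'=\max_{j\le R}(\hat q+\theta^{(j)}\hat\sigma_q)$, replaces each of these numbers that lies outside $[0,1]$ by the nearest point of $[0,1]$ (the payoff being defined for probabilities only), offers a sequence $S^t$ of distinct items that maximizes $\mathbb E[U(S;u',q')]$ (ties broken arbitrarily, without knowledge of the future), and updates the counters with the reactions to the viewed items. \textbf{Theorem.} Let $\alpha>0$ and $\beta\ge2$. There are positive constants $C_1,C_2,C_3$, depending only on $\alpha$ and $\beta$, such that for all $N$, $T$, $R\ge1$ and all $r,u\in[0,1]^N$, $c,q\in[0,1]$, with $S^*$ a maximizer of $\mathbb E[U(S;u,q)]$, the expected pseudo-regret of SBORS satisfies $$\mathbb E\Big[\sum_{t=1}^T\big(\mathbb E[U(S^*;u,q)]-\mathbb E[U(S^t;u,q)]\big)\Big]\le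 C_1N^2\sqrt{NT\log(TR)}+C_2N\sqrt{T\log(TR)\,\log T}+\frac{C_3N}{R}.$$ -/

import Mathlib

open MeasureTheory ProbabilityTheory
open scoped ENNReal

/-! Sequential recommendation with user abandonment, and Thompson sampling with Gaussian
posterior approximation and correlated sampling (SBORS). Items are the elements of `Fin N`,
a sequence of items is a list without repetitions (possibly empty). -/

namespace SBORS

noncomputable section

variable {N : ℕ}

/-! ### The payoff of a sequence of items -/

/-- Probability that the user selects the item in position `k` (counted from `0`) of `S`. -/
def selectProb (u : Fin N → ℝ) (q : ℝ) (S : List (Fin N)) (k : Fin S.length) : ℝ :=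
  q ^ (k : ℕ) * (∏ j ∈ Finset.Iio k, (1 - u (S.get j))) * u (S.get k)

/-- Probability that the user abandons the platform while viewing `S`. -/
def abandonProb (u : Fin N → ℝ) (q : ℝ) (S : List (Fin N)) : ℝ :=
  ∑ k : Fin S.length, q ^ (k : ℕ) * (1 - q) * ∏ j ∈ Finset.Iic k, (1 - u (S.get j))

/-- The expected payoff `𝔼[U(S; u, q)]`: revenue `r i` for a selected item `i`, penalty `c` for
an abandonment. -/
def utility (r : Fin N → ℝ) (c : ℝ) (u : Fin N → ℝ) (q : ℝ) (S : List (Fin N)) : ℝ :=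
  ∑ k : Fin S.length, selectProb u q S k * r (S.get k) - c * abandonProb u q S

/-- `S` maximizes the expected payoff among all sequences of distinct items. -/
def IsOptimal (r : Fin N → ℝ) (c : ℝ) (u : Fin N → ℝ) (q : ℝ) (S : List (Fin N)) : Prop :=
  S.Nodup ∧ ∀ S' : List (Fin N), S'.Nodup → utility r c u q S' ≤ utility r c u q S

/-! ### The behaviour of a user -/

/-- The reaction of a user to one viewed item. -/
inductive Reaction
  | select
  | continue
  | abandon

/-- The viewed items and the reactions to them, when the items of the list are shown from
position `k` on and all `k - 1` earlier items were unsatisfying. `click i` says whether the user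
selects item `i` when viewing it, and `W` is the patience: the user abandons the platform after
the `W`-th unsatisfying item. -/
def feedbackFrom (click : Fin N → Bool) (W : ℕ∞) : ℕ → List (Fin N) → List (Fin N × Reaction)
  | _, [] => []
  | k, i :: l =>
    open Classical in
    if click i = true then [(i, Reaction.select)]
    else if W ≤ (k : ℕ∞) then [(i, Reaction.abandon)]
    else (i, Reaction.continue) :: feedbackFrom click W (k + 1) l

/-- The feedback of a user to whom `S` is offered. -/
def feedback (click : Fin N → Bool) (W : ℕ∞) (S : List (Fin N)) : List (Fin N × Reaction) :=
  feedbackFrom click W 1 S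

/-! ### The state of the algorithm -/

/-- The counters of the algorithm: selections `sel i` and non-selections `unsel i` of item `i`,
and the numbers `cont`, `aband` of viewed, not selected items without / with abandonment. -/
structure Counts (N : ℕ) where
  sel : Fin N → ℕ
  unsel : Fin N → ℕ
  cont : ℕ
  aband : ℕ

/-- All counters start at `1`. -/
def Counts.init (N : ℕ) : Counts N := ⟨fun _ => 1, fun _ => 1, 1, 1⟩

/-- Update for one viewed item. -/
def Counts.update (s : Counts N) : Fin N × Reaction → Counts N
  | (i, Reaction.select) => { s with sel := Function.update s.sel i (s.sel i + 1) }
  | (i, Reaction.continue) =>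
      { s with unsel := Function.update s.unsel i (s.unsel i + 1), cont := s.cont + 1 }
  | (i, Reaction.abandon) =>
      { s with unsel := Function.update s.unsel i (s.unsel i + 1), aband := s.aband + 1 }

/-- Update for all items viewed in one round. -/
def Counts.updateAll (s : Counts N) (l : List (Fin N × Reaction)) : Counts N :=
  l.foldl Counts.update s

/-- Empirical mean, from `a` successes and `b` failures. -/
def postMean (a b : ℕ) : ℝ := (a : ℝ) / ((a : ℝ) + (b : ℝ))

/-- Standard deviation of the approximating Gaussian, from `a` successes and `b` failures. -/
def postStd (α β : ℝ) (a b : ℕ) : ℝ :=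
  √(α * postMean a b * (1 - postMean a b) / ((a : ℝ) + (b : ℝ) + 1)) + √(β / ((a : ℝ) + (b : ℝ)))

/-- The largest of the `R` correlated samples: `max_j (mean + θ_j * std)`. -/
def maxSample (α β : ℝ) {R : ℕ} (θ : Fin R → ℝ) (a b : ℕ) : ℝ :=
  ⨆ j : Fin R, (postMean a b + θ j * postStd α β a b)

/-- The sampled value `u'_i` of the selection probability of item `i`. -/
def sampleU (α β : ℝ) {R : ℕ} (θ : Fin R → ℝ) (s : Counts N) (i : Fin N) : ℝ :=
  maxSample α β θ (s.sel i) (s.unsel i)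

/-- The sampled value `q'` of the probability of not abandoning. -/
def sampleQ (α β : ℝ) {R : ℕ} (θ : Fin R → ℝ) (s : Counts N) : ℝ :=
  maxSample α β θ s.cont s.aband

/-- The point of `[0, 1]` nearest to `x`. -/
def toUnit (x : ℝ) : ℝ := max 0 (min 1 x)

/-- Counters at the beginning of round `t` (rounds are `0, 1, 2, …`), for given offered sequences,
clicks and patiences in the rounds. -/
def counts (seq : ℕ → List (Fin N)) (click : ℕ → Fin N → Bool) (W : ℕ → ℕ∞) : ℕ → Counts N
  | 0 => Counts.init N
  | t + 1 => (counts seq click W t).updateAll (feedback (click t) (W t) (seq t))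

/-! ### A run of the algorithm -/

/-- A run of SBORS with parameters `α, β, R` on a probability space, where the users have selection
probabilities `u` and a patience with tail `q ^ k`. Ties in the choice of the sequences may be broken
in any way that does not look into the future, also at random. -/
structure Run (α β : ℝ) (R : ℕ) (r : Fin N → ℝ) (c : ℝ) (u : Fin N → ℝ) (q : ℝ)
    {Ω : Type*} [mΩ : MeasurableSpace Ω] (μ : Measure Ω) where
  /-- events known at the beginning of round `t` -/
  past : ℕ → MeasurableSpace Ω
  /-- events known when the sequence of round `t` has been chosen -/
  present : ℕ → MeasurableSpace Ω
  past_le_present : ∀ t, past t ≤ present t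
  present_le_past : ∀ t, present t ≤ past (t + 1)
  present_le : ∀ t, present t ≤ mΩ
  /-- the `R` Gaussian samples of round `t` -/
  θ : ℕ → Ω → Fin R → ℝ
  /-- the sequence offered in round `t` -/
  seq : ℕ → Ω → List (Fin N)
  /-- the items that the user of round `t` selects if viewing them -/
  click : ℕ → Ω → Fin N → Bool
  /-- the patience of the user of round `t` -/
  patience : ℕ → Ω → ℕ∞
  measurable_θ : ∀ t, Measurable[present t] (θ t)
  measurable_seq : ∀ t s, MeasurableSet[present t] {ω | seq t ω = s}
  measurable_click : ∀ t, Measurable[past (t + 1)] (click t)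
  measurable_patience : ∀ t, Measurable[past (t + 1)] (patience t)
  /-- the samples of a round are independent standard Gaussians, -/
  law_θ : ∀ t, μ.map (θ t) = Measure.pi fun _ : Fin R => gaussianReal 0 1
  /-- independent of the past. -/
  indep_θ : ∀ t, Indep (past t) (MeasurableSpace.comap (θ t) inferInstance) μ
  /-- Independently of all that precedes the user's reaction, the clicks on the items and the
  patience of the user are independent, with `P(click i) = u i` and `P(patience > k) = q ^ k`. -/
  law_user : ∀ (t : ℕ) (A : Set Ω), MeasurableSet[present t] A → ∀ (b : Fin N → Bool) (k : ℕ),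
    μ (A ∩ {ω | click t ω = b ∧ (k : ℕ∞) < patience t ω}) =
      μ A * ENNReal.ofReal ((∏ i, if b i = true then u i else 1 - u i) * q ^ k)
  /-- The offered sequence is optimal for the sampled parameters. The payoff is a function of
  probabilities, so a sample outside of `[0, 1]` is replaced by the nearest probability. -/
  optimal : ∀ t ω,
    let s := counts (fun m => seq m ω) (fun m => click m ω) (fun m => patience m ω) t
    IsOptimal r c (fun i => toUnit (sampleU α β (θ t ω) s i)) (toUnit (sampleQ α β (θ t ω) s))
      (seq t ω)

/-- Expected pseudo-regret over `T` rounds, against the sequence `Sopt`: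
`𝔼 ∑_t (𝔼[U(Sopt; u, q)] - 𝔼[U(S^t; u, q)])`. -/
def Run.regret {α β : ℝ} {R : ℕ} {r : Fin N → ℝ} {c : ℝ} {u : Fin N → ℝ} {q : ℝ}
    {Ω : Type*} [MeasurableSpace Ω] {μ : Measure Ω} (X : Run α β R r c u q μ)
    (Sopt : List (Fin N)) (T : ℕ) : ℝ :=
  ∫ ω, ∑ t ∈ Finset.range T, (utility r c u q Sopt - utility r c u q (X.seq t ω)) ∂μ

end

end SBORS

namespace SBORS

noncomputable section

variable {N : ℕ}

/-! ### The payoff -/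

/-! Let `V` be the optimal true payoff, `s` the counters at the start of a round, `G s θ` the
optimal payoff for the parameters sampled with `θ`, `m s` its mean over `θ`, and `D` a common bound
for all deviations of the empirical means, in units of `1/√n`. Given `s`, `G` has mean `m`, so the
expected regret of a round is that of `(V - m) + (G - U(S^t))`.

The first term is controlled by optimism. All parameters are sampled with the same Gaussians, so a
single event `θ 0 ≥ D/√β` puts every sampled parameter above the true one. Then `G ≥ V`, because the
optimal payoff is monotone in the parameters (`utility_le_of_isOptimal`). This event has probability
at least a constant times `exp(-D²/3)`, by `β ≥ 2`. Hence `V - m` is at most a constant times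
`exp(D²/3)` times the mean of `(G - m)⁺` (`utility_sub_meanSampledValue_le`). Both `(G - m)⁺` and `G
- U(S^t)` concern the sequence actually offered, and are bounded by a factor in `D`, `‖θ‖` times the
expected sum of `1/√n` over the views of this sequence (`optimismFactor_mul_add_le`).

The resulting product `y · ∑ 1/√n` has correlated factors. Young's inequality with exponents `3` and
`3/2` separates them into `δ² y³` and `δ⁻¹ n^(-3/4)`. The third moment of `y` costs `exp(D²)` times
a polynomial, which fits under `exp(3D²/2)`; this lies below the Hoeffding exponent `2D²`, so
exponential supermartingales bound its mean up to a logarithm (`integral_devWeight_le`). The sum of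
`n^(-3/4)` over all views is paid by a potential made of fourth roots of the counters
(`potential_add_viewSum_le`), of final size `N T^(1/4)`.

Optimizing `δ` gives a bound of order `N (N + √log T) √T √log(2R)` (`regret_le`), which is slightly
stronger than the claim. -/

lemma Iio_succ_eq_cons {n : ℕ} (k : Fin n) :
    Finset.Iio k.succ = Finset.cons 0 ((Finset.Iio k).map (Fin.succEmb n)) (by simp) := by
  ext j
  refine Fin.cases ?_ (fun j => ?_) j <;> simp

lemma Iic_succ_eq_cons {n : ℕ} (k : Fin n) :
    Finset.Iic k.succ = Finset.cons 0 ((Finset.Iic k).map (Fin.succEmb n)) (by simp) := by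
  ext j
  refine Fin.cases ?_ (fun j => ?_) j <;> simp

@[simp] lemma utility_nil (r : Fin N → ℝ) (c : ℝ) (u : Fin N → ℝ) (q : ℝ) :
    utility r c u q [] = 0 := by
  simp [utility, abandonProb]

/-- Conditioning on the reaction to the first item. This recursion turns later statements about
payoffs into inductions over the list. -/
lemma utility_cons (r : Fin N → ℝ) (c : ℝ) (u : Fin N → ℝ) (q : ℝ) (i : Fin N)
    (l : List (Fin N)) :
    utility r c u q (i :: l)
      = u i * r i + (1 - u i) * (q * utility r c u q l - (1 - q) * c) := by
  have h1 : ∑ k : Fin (i :: l).length, selectProb u q (i :: l) k * r ((i :: l).get k)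
      = u i * r i + (1 - u i) * q * ∑ k : Fin l.length, selectProb u q l k * r (l.get k) := by
    change ∑ k : Fin (l.length + 1), selectProb u q (i :: l) k * r ((i :: l).get k) = _
    rw [Fin.sum_univ_succ, Finset.mul_sum]
    congr 1
    · have : Finset.Iio (0 : Fin (l.length + 1)) = ∅ := by ext j; simp
      simp [selectProb, this]
    · refine Finset.sum_congr rfl fun k _ => ?_
      have : ∏ j ∈ Finset.Iio k.succ, (1 - u ((i :: l).get j))
          = (1 - u i) * ∏ j ∈ Finset.Iio k, (1 - u (l.get j)) := by
        rw [Iio_succ_eq_cons, Finset.prod_cons, Finset.prod_map]; rfl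
      have e : selectProb u q (i :: l) k.succ
          = q ^ ((k : ℕ) + 1) * ((1 - u i) * ∏ j ∈ Finset.Iio k, (1 - u (l.get j)))
            * u (l.get k) := by
        rw [← this]; rfl
      change selectProb u q (i :: l) k.succ * r (l.get k) = _
      rw [e, selectProb]
      ring
  have h2 : abandonProb u q (i :: l)
      = (1 - u i) * (1 - q) + (1 - u i) * q * abandonProb u q l := by
    unfold abandonProb
    change ∑ k : Fin (l.length + 1), q ^ (k : ℕ) * (1 - q) *
      ∏ j ∈ Finset.Iic k, (1 - u ((i :: l).get j)) = _
    rw [Fin.sum_univ_succ, Finset.mul_sum]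
    congr 1
    · have : Finset.Iic (0 : Fin (l.length + 1)) = {0} := by
        ext j; simp
      rw [this]; simp [mul_comm]
    · refine Finset.sum_congr rfl fun k _ => ?_
      have : ∏ j ∈ Finset.Iic k.succ, (1 - u ((i :: l).get j))
          = (1 - u i) * ∏ j ∈ Finset.Iic k, (1 - u (l.get j)) := by
        rw [Iic_succ_eq_cons, Finset.prod_cons, Finset.prod_map]; rfl
      rw [this]
      simp only [Fin.val_succ]
      ring
  unfold utility
  rw [h1, h2]; ring

lemma utility_mem_Icc {r : Fin N → ℝ} {c : ℝ} {u : Fin N → ℝ} {q : ℝ}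
    (hr : ∀ i, r i ∈ Set.Icc (0 : ℝ) 1) (hc : c ∈ Set.Icc (0 : ℝ) 1)
    (hu : ∀ i, u i ∈ Set.Icc (0 : ℝ) 1) (hq : q ∈ Set.Icc (0 : ℝ) 1) (S : List (Fin N)) :
    utility r c u q S ∈ Set.Icc (-c) 1 := by
  induction S with
  | nil => simpa using hc.1
  | cons i l ih =>
    rw [utility_cons]
    obtain ⟨h1, h2⟩ := hr i
    obtain ⟨h3, h4⟩ := hu i
    obtain ⟨h5, h6⟩ := hq
    obtain ⟨h7, h8⟩ := hc
    obtain ⟨h9, h10⟩ := ih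
    have a1 : -c ≤ q * utility r c u q l - (1 - q) * c := by nlinarith
    have a2 : q * utility r c u q l - (1 - q) * c ≤ 1 := by nlinarith
    constructor <;> nlinarith

/-- For a fixed sequence the payoff is not monotone in `u`: a larger `u i` hurts if `r i` is below
the value of continuing. Such items are dropped, whence the sublist. Nonnegativity is carried
through the induction, the empty list being available whenever it would fail. -/
lemma exists_sublist_utility_le {r : Fin N → ℝ} {c : ℝ} {u u' : Fin N → ℝ} {q q' : ℝ}
    (hc : 0 ≤ c) (hu : ∀ i, u i ∈ Set.Icc (0 : ℝ) 1) (hq : 0 ≤ q)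
    (hq' : q' ≤ 1) (huu : ∀ i, u i ≤ u' i) (hqq : q ≤ q') (S : List (Fin N)) :
    ∃ S' : List (Fin N), S'.Sublist S ∧ 0 ≤ utility r c u' q' S' ∧
      utility r c u q S ≤ utility r c u' q' S' := by
  induction S with
  | nil => exact ⟨[], by simp⟩
  | cons i l ih =>
    obtain ⟨l', hl, h0, hle⟩ := ih
    set V := utility r c u' q' l'
    set B := q' * V - (1 - q') * c with hB
    -- Here `V - B = (1 - q') (V + c)`, so nonnegativity of `V` is what is used.
    have hBV : B ≤ V := by nlinarith
    have h1 : q * utility r c u q l - (1 - q) * c ≤ B := by nlinarith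
    have h2 : utility r c u q (i :: l) ≤ u i * r i + (1 - u i) * B := by
      rw [utility_cons]
      have := (hu i).2
      nlinarith
    -- If `i` pays at least the continuation value, raising `u i` helps. Otherwise omitting `i`
    -- gives `V ≥ B`, which beats any mixture of `r i` and `B`.
    by_cases hri : B ≤ r i
    · have h3 : utility r c u q (i :: l) ≤ utility r c u' q' (i :: l') := by
        rw [utility_cons r c u' q']
        change _ ≤ u' i * r i + (1 - u' i) * B
        nlinarith [huu i]
      by_cases h4 : 0 ≤ utility r c u' q' (i :: l')
      · exact ⟨i :: l', hl.cons_cons i, h4, h3⟩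
      · exact ⟨[], by simp, by simp, by simp; linarith⟩
    · refine ⟨l', hl.cons i, h0, ?_⟩
      have := (hu i).1
      nlinarith

lemma utility_le_of_isOptimal {r : Fin N → ℝ} {c : ℝ} {u u' : Fin N → ℝ} {q q' : ℝ}
    (hc : 0 ≤ c) (hu : ∀ i, u i ∈ Set.Icc (0 : ℝ) 1) (hq : 0 ≤ q)
    (hq' : q' ≤ 1) (huu : ∀ i, u i ≤ u' i) (hqq : q ≤ q') {S S' : List (Fin N)} (hS : S.Nodup)
    (hS' : IsOptimal r c u' q' S') : utility r c u q S ≤ utility r c u' q' S' := by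
  obtain ⟨l, hl, -, h⟩ := exists_sublist_utility_le (r := r) hc hu hq hq' huu hqq S
  exact h.trans (hS'.2 l (hS.sublist hl))

/-! ### Expected totals over the viewed items -/

/-- Expected value of the sum of `g i` over the viewed items `i` and of `g'` over the viewed items
that are not selected. -/
def viewSum (u : Fin N → ℝ) (q : ℝ) (g : Fin N → ℝ) (g' : ℝ) : List (Fin N) → ℝ
  | [] => 0
  | i :: l => g i + (1 - u i) * (g' + q * viewSum u q g g' l)

lemma viewSum_nonneg {u : Fin N → ℝ} {q : ℝ} (hu : ∀ i, u i ∈ Set.Icc (0 : ℝ) 1) (hq : 0 ≤ q)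
    {g : Fin N → ℝ} {g' : ℝ} (hg : ∀ i, 0 ≤ g i) (hg' : 0 ≤ g') (S : List (Fin N)) :
    0 ≤ viewSum u q g g' S := by
  induction S with
  | nil => simp [viewSum]
  | cons i l ih =>
    have := sub_nonneg.2 (hu i).2
    have := hg i
    simp only [viewSum]
    positivity

lemma viewSum_mono {u : Fin N → ℝ} {q : ℝ} (hu : ∀ i, u i ∈ Set.Icc (0 : ℝ) 1) (hq : 0 ≤ q)
    {f g : Fin N → ℝ} {f' g' : ℝ} (hg : ∀ i, f i ≤ g i) (hg' : f' ≤ g') (S : List (Fin N)) :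
    viewSum u q f f' S ≤ viewSum u q g g' S := by
  induction S with
  | nil => simp [viewSum]
  | cons i l ih =>
    have := sub_nonneg.2 (hu i).2
    have := hg i
    simp only [viewSum]
    gcongr

lemma viewSum_mul (u : Fin N → ℝ) (q a : ℝ) (g : Fin N → ℝ) (g' : ℝ) (S : List (Fin N)) :
    viewSum u q (fun i => a * g i) (a * g') S = a * viewSum u q g g' S := by
  induction S with
  | nil => simp [viewSum]
  | cons i l ih => simp only [viewSum, ih]; ring

lemma viewSum_add (u : Fin N → ℝ) (q : ℝ) (f g : Fin N → ℝ) (f' g' : ℝ) (S : List (Fin N)) :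
    viewSum u q (fun i => f i + g i) (f' + g') S
      = viewSum u q f f' S + viewSum u q g g' S := by
  induction S with
  | nil => simp [viewSum]
  | cons i l ih => simp only [viewSum, ih]; ring

lemma viewSum_const_one_le {u : Fin N → ℝ} {q : ℝ} (hu : ∀ i, u i ∈ Set.Icc (0 : ℝ) 1)
    (hq : q ∈ Set.Icc (0 : ℝ) 1) (S : List (Fin N)) :
    viewSum u q (fun _ => 1) 1 S ≤ 2 * S.length := by
  induction S with
  | nil => simp [viewSum]
  | cons i l ih =>
    have h0 := viewSum_nonneg hu hq.1 (g := fun _ => 1) (g' := 1) (by simp) (by simp) l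
    have := hu i
    have h1 : q * viewSum u q (fun _ => 1) 1 l ≤ 2 * l.length := by nlinarith [hq.1, hq.2]
    have h2 : 0 ≤ q * viewSum u q (fun _ => 1) 1 l := mul_nonneg hq.1 h0
    simp only [viewSum, List.length_cons, Nat.cast_add, Nat.cast_one]
    nlinarith [this.1, this.2]

/-- Parameters are exchanged one viewed item at a time. The errors are weighted by the true viewing
probabilities, so they can later be charged to views that really occur. -/
lemma abs_utility_sub_le {r : Fin N → ℝ} {c : ℝ} {u x : Fin N → ℝ} {q y : ℝ}
    (hr : ∀ i, r i ∈ Set.Icc (0 : ℝ) 1) (hc : c ∈ Set.Icc (0 : ℝ) 1)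
    (hu : ∀ i, u i ∈ Set.Icc (0 : ℝ) 1) (hq : q ∈ Set.Icc (0 : ℝ) 1)
    (hx : ∀ i, x i ∈ Set.Icc (0 : ℝ) 1) (hy : y ∈ Set.Icc (0 : ℝ) 1) (S : List (Fin N)) :
    |utility r c x y S - utility r c u q S|
      ≤ 2 * viewSum u q (fun i => |x i - u i|) |y - q| S := by
  induction S with
  | nil => simp [viewSum]
  | cons i l ih =>
    obtain ⟨v1, v2⟩ := utility_mem_Icc hr hc hx hy l
    set V := utility r c x y l
    set V₀ := utility r c u q l
    -- The continuation value is kept at the perturbed parameters in the first two differences; only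
    -- then do the true `u i` and `q` multiply the remaining difference `V - V₀`.
    have e : utility r c x y (i :: l) - utility r c u q (i :: l)
        = (x i - u i) * (r i - (y * V - (1 - y) * c))
          + (1 - u i) * ((y - q) * (V + c) + q * (V - V₀)) := by
      rw [utility_cons, utility_cons]; ring
    have b1 : |r i - (y * V - (1 - y) * c)| ≤ 2 := by
      have := hr i
      rw [abs_le]
      constructor <;> nlinarith [this.1, this.2, hy.1, hy.2, hc.1, hc.2]
    have b2 : |V + c| ≤ 2 := by
      rw [abs_le]
      constructor <;> linarith [hc.1, hc.2]
    have hui := sub_nonneg.2 (hu i).2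
    rw [e]
    calc _ ≤ |x i - u i| * |r i - (y * V - (1 - y) * c)|
          + (1 - u i) * (|y - q| * |V + c| + q * |V - V₀|) := by
          refine (abs_add_le _ _).trans ?_
          rw [abs_mul, abs_mul, abs_of_nonneg hui]
          gcongr
          refine (abs_add_le _ _).trans ?_
          rw [abs_mul, abs_mul, abs_of_nonneg hq.1]
      _ ≤ |x i - u i| * 2 + (1 - u i) * (|y - q| * 2
            + q * (2 * viewSum u q (fun i => |x i - u i|) |y - q| l)) := by
          have := hq.1
          gcongr
      _ = _ := by simp only [viewSum]; ring

/-- A weighted form of Young's inequality with exponents `3` and `3 / 2`. -/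
lemma div_sq_le_young {y δ v : ℝ} (hy : 0 ≤ y) (hδ : 0 < δ) (hv : 0 < v) :
    y * (1 / v ^ 2) ≤ δ ^ 2 * y ^ 3 + δ⁻¹ * (1 / v ^ 3) := by
  have h2 : 0 ≤ δ⁻¹ * (1 / v ^ 3) := by positivity
  have h1 : 0 ≤ δ ^ 2 * y ^ 3 := by positivity
  rcases le_total (y * δ * v) 1 with h | h
  · have : y * (1 / v ^ 2) ≤ δ⁻¹ * (1 / v ^ 3) := by
      have e : δ⁻¹ * (1 / v ^ 3) - y * (1 / v ^ 2) = (1 - y * δ * v) * (δ⁻¹ * (1 / v ^ 3)) := by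
        field_simp
      nlinarith
    linarith
  · have : y * (1 / v ^ 2) ≤ δ ^ 2 * y ^ 3 := by
      have e : δ ^ 2 * y ^ 3 = (y * δ * v) ^ 2 * (y * (1 / v ^ 2)) := by field_simp
      rw [e]
      exact le_mul_of_one_le_left (by positivity) (one_le_pow₀ h)
    linarith

/-! ### Exponential moments of Bernoulli variables -/

/-- Hoeffding's lemma for a Bernoulli variable. -/
lemma bernoulli_exp_le {p : ℝ} (hp : p ∈ Set.Icc (0 : ℝ) 1) (t : ℝ) :
    p * Real.exp (t * (1 - p)) + (1 - p) * Real.exp (t * (0 - p)) ≤ Real.exp (t ^ 2 / 8) := by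
  set μ : Measure Bool := ENNReal.ofReal p • Measure.dirac true
    + ENNReal.ofReal (1 - p) • Measure.dirac false with hμ
  have hp1 : 0 ≤ 1 - p := sub_nonneg.2 hp.2
  have : IsProbabilityMeasure μ := by
    constructor
    simp only [hμ, Measure.coe_add, Measure.coe_smul, Pi.add_apply, Pi.smul_apply, measure_univ,
      smul_eq_mul, mul_one]
    rw [← ENNReal.ofReal_add hp.1 hp1]
    simp
  have hint (f : Bool → ℝ) : ∫ b, f b ∂μ = p * f true + (1 - p) * f false := by
    have h (x : ℝ) (b : Bool) : Integrable f (ENNReal.ofReal x • Measure.dirac b) :=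
      (Integrable.of_finite (μ := Measure.dirac b)).smul_measure ENNReal.ofReal_ne_top
    rw [hμ, integral_add_measure (h _ _) (h _ _)]
    simp [integral_smul_measure, ENNReal.toReal_ofReal hp.1, ENNReal.toReal_ofReal hp1]
  have h := (hasSubgaussianMGF_of_mem_Icc (μ := μ) (X := fun b : Bool => if b then (1 : ℝ) else 0)
    (a := 0) (b := 1) Measurable.of_discrete.aemeasurable
    (Filter.Eventually.of_forall fun b => by cases b <;> simp)).mgf_le t
  rw [mgf, hint, hint] at h
  simp only [if_true, Bool.false_eq_true, if_false, mul_one, mul_zero, add_zero] at h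
  refine h.trans_eq ?_
  congr 1
  norm_num
  ring

/-- One of the exponents `t = ± 2 / 2 ^ k` is nearly optimal in the exponential inequality. -/
lemma exp_sq_div_le_sum {n M : ℝ} {K : ℕ} (hn : 0 < n) (hM : |M| ≤ n) (hK : n ≤ 4 ^ K) :
    Real.exp (3 / 2 * (M ^ 2 / n)) ≤ Real.exp (3 / 2)
      + ∑ k ∈ Finset.range K, (Real.exp (2 / 2 ^ k * M - (2 / 2 ^ k) ^ 2 * n / 8)
        + Real.exp (-(2 / 2 ^ k) * M - (-(2 / 2 ^ k)) ^ 2 * n / 8)) := by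
  set x := |M| / n with hx
  have hxM : |M| = x * n := by rw [hx]; field_simp
  have hM2 : M ^ 2 / n = x ^ 2 * n := by
    rw [← sq_abs, hxM]; field_simp
  have hx1 : x ≤ 1 := (div_le_one hn).2 hM
  have hx0 : 0 ≤ x := by positivity
  rw [hM2]
  -- For `x ≤ 2^(-K)` the exponent is at most `3/2`, since `n ≤ 4^K`; larger `x` are reached by the
  -- dyadic grid.
  rcases le_or_gt x ((1 / 2) ^ K) with h | h
  · have h1 : x ^ 2 * n ≤ 1 := by
      calc x ^ 2 * n ≤ ((1 / 2) ^ K) ^ 2 * 4 ^ K := by gcongr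
        _ = ((1 / 2) ^ 2 * 4) ^ K := by rw [mul_pow, pow_right_comm]
        _ = 1 := by norm_num
    have h2 : Real.exp (3 / 2 * (x ^ 2 * n)) ≤ Real.exp (3 / 2) :=
      Real.exp_le_exp.2 (by linarith)
    have : 0 ≤ ∑ k ∈ Finset.range K, (Real.exp (2 / 2 ^ k * M - (2 / 2 ^ k) ^ 2 * n / 8)
        + Real.exp (-(2 / 2 ^ k) * M - (-(2 / 2 ^ k)) ^ 2 * n / 8)) :=
      Finset.sum_nonneg fun _ _ => add_nonneg (Real.exp_pos _).le (Real.exp_pos _).le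
    linarith
  · have hxpos : 0 < x := lt_trans (by positivity) h
    obtain ⟨k, hk1, hk2⟩ := exists_nat_pow_near_of_lt_one hxpos hx1
      (by norm_num : (0 : ℝ) < 1 / 2) (by norm_num)
    have hkK : k < K := by
      by_contra hcon
      have : ((1 : ℝ) / 2) ^ k ≤ (1 / 2) ^ K :=
        pow_le_pow_of_le_one (by norm_num) (by norm_num) (not_lt.1 hcon)
      linarith
    set t : ℝ := 2 / 2 ^ k with ht
    have ht0 : 0 < t := by positivity
    have e1 : t = 4 * (1 / 2) ^ (k + 1) := by
      rw [ht, one_div, inv_pow, pow_succ]; field_simp; norm_num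
    have e2 : t = 2 * (1 / 2) ^ k := by
      rw [ht, one_div, inv_pow]; field_simp
    have h1 : t ≤ 4 * x := by rw [e1]; linarith
    have h2 : 2 * x ≤ t := by rw [e2]; linarith
    -- The optimal `t = 4x` would give `2 x² n`. A grid point with `2x ≤ t ≤ 4x` still gives `3/2`,
    -- attained at `t = 2x`.
    have h3 : 3 / 2 * (x ^ 2 * n) ≤ t * |M| - t ^ 2 * n / 8 := by
      rw [hxM]
      nlinarith [mul_nonneg (mul_nonneg (sub_nonneg.2 h1) (sub_nonneg.2 h2)) hn.le,
        mul_nonneg (mul_nonneg (sub_nonneg.2 h2) hx0) hn.le]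
    have h4 : Real.exp (3 / 2 * (x ^ 2 * n))
        ≤ Real.exp (t * M - t ^ 2 * n / 8) + Real.exp (-t * M - (-t) ^ 2 * n / 8) := by
      refine (Real.exp_le_exp.2 h3).trans ?_
      rcases abs_cases M with ⟨h, -⟩ | ⟨h, -⟩
      · rw [h]
        exact le_add_of_nonneg_right (Real.exp_pos _).le
      · have e : t * |M| - t ^ 2 * n / 8 = -t * M - (-t) ^ 2 * n / 8 := by rw [h]; ring
        rw [e]
        exact le_add_of_nonneg_left (Real.exp_pos _).le
    refine h4.trans ((Finset.single_le_sum (f := fun k : ℕ =>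
      Real.exp (2 / 2 ^ k * M - (2 / 2 ^ k) ^ 2 * n / 8)
        + Real.exp (-(2 / 2 ^ k) * M - (-(2 / 2 ^ k)) ^ 2 * n / 8))
      (fun _ _ => add_nonneg (Real.exp_pos _).le (Real.exp_pos _).le) (Finset.mem_range.2 hkK)).trans ?_)
    exact le_add_of_nonneg_left (Real.exp_pos _).le

/-! ### Expectations over the reactions of a user -/

/-- Expected value of a function of the feedback to `S`. -/
def expFeedback (u : Fin N → ℝ) (q : ℝ) :
    List (Fin N) → (List (Fin N × Reaction) → ℝ) → ℝ
  | [], F => F []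
  | i :: l, F => u i * F [(i, Reaction.select)] + (1 - u i) * ((1 - q) * F [(i, Reaction.abandon)]
      + q * expFeedback u q l (fun m => F ((i, Reaction.continue) :: m)))

/-- A supermartingale for single views remains one over a whole round, although the number of views
is random: the induction stops where the user does. -/
lemma expFeedback_updateAll_le {u : Fin N → ℝ} {q : ℝ} (hu : ∀ i, u i ∈ Set.Icc (0 : ℝ) 1)
    (hq : q ∈ Set.Icc (0 : ℝ) 1) {Z : Counts N → ℝ}
    (hZ : ∀ s i, u i * Z (s.update (i, Reaction.select))
      + (1 - u i) * ((1 - q) * Z (s.update (i, Reaction.abandon))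
        + q * Z (s.update (i, Reaction.continue))) ≤ Z s) (S : List (Fin N)) (s : Counts N) :
    expFeedback u q S (fun m => Z (s.updateAll m)) ≤ Z s := by
  induction S generalizing s with
  | nil => simp [expFeedback, Counts.updateAll]
  | cons i l ih =>
    refine le_trans ?_ (hZ s i)
    have h1 := sub_nonneg.2 (hu i).2
    have h2 := hq.1
    have h3 := ih (s.update (i, Reaction.continue))
    have h4 : (expFeedback u q l fun m => Z (s.updateAll ((i, Reaction.continue) :: m)))
        ≤ Z (s.update (i, Reaction.continue)) := h3
    simp only [expFeedback]
    exact add_le_add le_rfl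
      (mul_le_mul_of_nonneg_left (add_le_add le_rfl (mul_le_mul_of_nonneg_left h4 h2)) h1)

/-! ### Numbers of observations -/

/-- Number of observations, with the two initial ones, of item `i`. -/
def Counts.views (s : Counts N) (i : Fin N) : ℕ := s.sel i + s.unsel i

/-- Number of observations, with the two initial ones, of the decision to abandon. -/
def Counts.stays (s : Counts N) : ℕ := s.cont + s.aband

lemma views_update (s : Counts N) (i j : Fin N) (ρ : Reaction) :
    (s.update (i, ρ)).views j = s.views j + if j = i then 1 else 0 := by
  by_cases h : j = i
  · subst h
    cases ρ <;> simp [Counts.update, Counts.views] <;> ring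
  · cases ρ <;> simp [Counts.update, Counts.views, h]

lemma stays_update_select (s : Counts N) (i : Fin N) :
    (s.update (i, Reaction.select)).stays = s.stays := rfl

lemma stays_update_continue (s : Counts N) (i : Fin N) :
    (s.update (i, Reaction.continue)).stays = s.stays + 1 := by
  simp [Counts.update, Counts.stays]; ring

lemma stays_update_abandon (s : Counts N) (i : Fin N) :
    (s.update (i, Reaction.abandon)).stays = s.stays + 1 := by
  simp [Counts.update, Counts.stays]; ring

lemma views_le_views_updateAll (s : Counts N) (i : Fin N) (m : List (Fin N × Reaction)) :
    s.views i ≤ (s.updateAll m).views i := by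
  induction m generalizing s with
  | nil => rfl
  | cons x m ih =>
    refine le_trans ?_ (ih (s.update x))
    rw [views_update]; omega

lemma stays_le_stays_updateAll (s : Counts N) (m : List (Fin N × Reaction)) :
    s.stays ≤ (s.updateAll m).stays := by
  induction m generalizing s with
  | nil => rfl
  | cons x m ih =>
    refine le_trans ?_ (ih (s.update x))
    obtain ⟨i, ρ⟩ := x
    cases ρ <;> simp only [Counts.update, Counts.stays] <;> omega

lemma views_updateAll_feedbackFrom_le (click : Fin N → Bool) (W : ℕ∞) (k : ℕ) (S : List (Fin N))
    (s : Counts N) (i : Fin N) :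
    (s.updateAll (feedbackFrom click W k S)).views i ≤ s.views i + S.count i := by
  induction S generalizing s k with
  | nil => rfl
  | cons j l ih =>
    have hc : (j :: l).count i = l.count i + if i = j then 1 else 0 := by
      rw [List.count_cons]; simp only [beq_iff_eq, eq_comm (a := i)]
    rw [hc]
    unfold feedbackFrom
    by_cases h1 : click j = true
    · rw [if_pos h1]
      change (s.update (j, Reaction.select)).views i ≤ _
      rw [views_update]; omega
    rw [if_neg h1]
    by_cases h2 : W ≤ (k : ℕ∞)
    · rw [if_pos h2]
      change (s.update (j, Reaction.abandon)).views i ≤ _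
      rw [views_update]; omega
    · rw [if_neg h2]
      refine (ih (k + 1) (s.update (j, Reaction.continue))).trans ?_
      rw [views_update]
      omega

lemma stays_updateAll_feedbackFrom_le (click : Fin N → Bool) (W : ℕ∞) (k : ℕ) (S : List (Fin N))
    (s : Counts N) :
    (s.updateAll (feedbackFrom click W k S)).stays ≤ s.stays + S.length := by
  induction S generalizing s k with
  | nil => rfl
  | cons j l ih =>
    rw [List.length_cons]
    unfold feedbackFrom
    split_ifs
    · change (s.update (j, Reaction.select)).stays ≤ _
      rw [stays_update_select]; omega
    · change (s.update (j, Reaction.abandon)).stays ≤ _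
      rw [stays_update_abandon]; omega
    · refine (ih (k + 1) (s.update (j, Reaction.continue))).trans ?_
      rw [stays_update_continue]; omega

section counts

variable (seq : ℕ → List (Fin N)) (click : ℕ → Fin N → Bool) (W : ℕ → ℕ∞)

lemma two_le_views_counts (t : ℕ) (i : Fin N) : 2 ≤ (counts seq click W t).views i := by
  induction t with
  | zero => rfl
  | succ t ih => exact ih.trans (views_le_views_updateAll _ _ _)

lemma two_le_stays_counts (t : ℕ) : 2 ≤ (counts seq click W t).stays := by
  induction t with
  | zero => rfl
  | succ t ih => exact ih.trans (stays_le_stays_updateAll _ _)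

lemma views_counts_le (hS : ∀ t, (seq t).Nodup) (t : ℕ) (i : Fin N) :
    (counts seq click W t).views i ≤ t + 2 := by
  induction t with
  | zero => rfl
  | succ t ih =>
    have h1 := views_updateAll_feedbackFrom_le (click t) (W t) 1 (seq t) (counts seq click W t) i
    have h2 := List.nodup_iff_count_le_one.1 (hS t) i
    simp only [counts, feedback]
    omega

lemma stays_counts_le (hS : ∀ t, (seq t).Nodup) (t : ℕ) :
    (counts seq click W t).stays ≤ N * t + 2 := by
  induction t with
  | zero => rfl
  | succ t ih =>
    have h1 := stays_updateAll_feedbackFrom_le (click t) (W t) 1 (seq t) (counts seq click W t)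
    have h2 : (seq t).length ≤ N := by simpa using (hS t).length_le_card
    simp only [counts, feedback]
    rw [mul_add]
    omega

end counts

/-! ### Exponential supermartingales -/

/-- Exponential martingale factor, for `a` successes and `b` failures of probability `p`. -/
def expWeight (p t : ℝ) (a b : ℕ) : ℝ :=
  Real.exp (t * (a - p * (a + b)) - t ^ 2 * (a + b) / 8)

/-- The compensator `t²/8` per observation is exactly the Hoeffding bound on the logarithm of the
moment generating function. -/
lemma expWeight_step {p : ℝ} (hp : p ∈ Set.Icc (0 : ℝ) 1) (t : ℝ) (a b : ℕ) :
    p * expWeight p t (a + 1) b + (1 - p) * expWeight p t a (b + 1) ≤ expWeight p t a b := by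
  have e1 : expWeight p t (a + 1) b
      = expWeight p t a b * Real.exp (-(t ^ 2 / 8)) * Real.exp (t * (1 - p)) := by
    simp only [expWeight, ← Real.exp_add]; congr 1; push_cast; ring
  have e2 : expWeight p t a (b + 1)
      = expWeight p t a b * Real.exp (-(t ^ 2 / 8)) * Real.exp (t * (0 - p)) := by
    simp only [expWeight, ← Real.exp_add]; congr 1; push_cast; ring
  have h0 : 0 ≤ expWeight p t a b := (Real.exp_pos _).le
  rw [e1, e2]
  calc _ = expWeight p t a b * Real.exp (-(t ^ 2 / 8))
        * (p * Real.exp (t * (1 - p)) + (1 - p) * Real.exp (t * (0 - p))) := by ring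
    _ ≤ expWeight p t a b * Real.exp (-(t ^ 2 / 8)) * Real.exp (t ^ 2 / 8) := by
        gcongr
        exact bernoulli_exp_le hp t
    _ = expWeight p t a b := by rw [mul_assoc, ← Real.exp_add]; simp

/-- The initial counters are one success and one failure that were never observed. They bias the
martingale only by a bounded factor. -/
lemma expWeight_one_le {p : ℝ} (hp : p ∈ Set.Icc (0 : ℝ) 1) {t : ℝ} (ht : |t| ≤ 2) :
    expWeight p t 1 1 ≤ Real.exp 2 := by
  refine Real.exp_le_exp.2 ?_
  obtain ⟨h1, h2⟩ := hp
  obtain ⟨h3, h4⟩ := abs_le.1 ht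
  push_cast
  nlinarith [sq_nonneg t]

lemma expFeedback_expWeight_item_le {u : Fin N → ℝ} {q : ℝ}
    (hu : ∀ i, u i ∈ Set.Icc (0 : ℝ) 1) (hq : q ∈ Set.Icc (0 : ℝ) 1) (i : Fin N) (t : ℝ)
    (S : List (Fin N)) (s : Counts N) :
    expFeedback u q S (fun m => expWeight (u i) t ((s.updateAll m).sel i)
      ((s.updateAll m).unsel i)) ≤ expWeight (u i) t (s.sel i) (s.unsel i) := by
  refine expFeedback_updateAll_le hu hq (Z := fun s => expWeight (u i) t (s.sel i) (s.unsel i))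
    (fun s j => ?_) S s
  by_cases h : i = j
  · subst h
    refine le_trans (le_of_eq ?_) (expWeight_step (hu i) t (s.sel i) (s.unsel i))
    simp [Counts.update]
    ring_nf
    simp
  · simp only [Counts.update, Function.update_of_ne h]
    exact le_of_eq (by ring)

lemma expFeedback_expWeight_stay_le {u : Fin N → ℝ} {q : ℝ}
    (hu : ∀ i, u i ∈ Set.Icc (0 : ℝ) 1) (hq : q ∈ Set.Icc (0 : ℝ) 1) (t : ℝ)
    (S : List (Fin N)) (s : Counts N) :
    expFeedback u q S (fun m => expWeight q t (s.updateAll m).cont (s.updateAll m).aband)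
      ≤ expWeight q t s.cont s.aband := by
  refine expFeedback_updateAll_le hu hq (Z := fun s => expWeight q t s.cont s.aband)
    (fun s j => ?_) S s
  have h1 := expWeight_step hq t s.cont s.aband
  have h2 := sub_nonneg.2 (hu j).2
  simp only [Counts.update]
  nlinarith

/-! ### A potential for the numbers of observations -/

/-- Fourth root. -/
def root4 (x : ℝ) : ℝ := √√x

lemma root4_pow_four {x : ℝ} (hx : 0 ≤ x) : root4 x ^ 4 = x := by
  rw [root4, show (4 : ℕ) = 2 * 2 from rfl, pow_mul, Real.sq_sqrt (Real.sqrt_nonneg _),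
    Real.sq_sqrt hx]

lemma root4_sq (x : ℝ) : root4 x ^ 2 = √x := Real.sq_sqrt (Real.sqrt_nonneg _)

lemma root4_nonneg (x : ℝ) : 0 ≤ root4 x := Real.sqrt_nonneg _

lemma root4_pos {x : ℝ} (hx : 0 < x) : 0 < root4 x := Real.sqrt_pos.2 (Real.sqrt_pos.2 hx)

lemma root4_mono {x y : ℝ} (h : x ≤ y) : root4 x ≤ root4 y :=
  Real.sqrt_le_sqrt (Real.sqrt_le_sqrt h)

lemma root4_mul {x : ℝ} (hx : 0 ≤ x) (y : ℝ) : root4 (x * y) = root4 x * root4 y := by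
  rw [root4, Real.sqrt_mul hx, Real.sqrt_mul (Real.sqrt_nonneg _), root4, root4]

lemma root4_one : root4 1 = 1 := by simp [root4]

lemma root4_two_pow_three_le : root4 2 ^ 3 ≤ 2 := by
  have h1 : 1 ≤ root4 2 := by rw [← root4_one]; exact root4_mono (by norm_num)
  have h2 := root4_pow_four (x := 2) (by norm_num)
  calc root4 2 ^ 3 ≤ root4 2 ^ 4 := pow_le_pow_right₀ h1 (by norm_num)
    _ = 2 := h2

lemma root4_two_le : root4 2 ≤ 2 := by
  have h1 : 1 ≤ root4 2 := by rw [← root4_one]; exact root4_mono (by norm_num)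
  calc root4 2 ≤ root4 2 ^ 4 := le_self_pow₀ h1 (by norm_num)
    _ = 2 := root4_pow_four (by norm_num)

/-- With `a`, `b` the two fourth roots, `a⁴ - b⁴ = 1` factors as `a - b` times a sum of at most `4
a³`. Here `n` is a current counter and `y` its value at the start of the round; `m` measures how far
it can have grown in between. -/
lemma one_div_le_root4_sub {n m y : ℝ} (hn : 0 ≤ n) (hm : 0 < m) (hy : 0 < y)
    (h : n + 1 ≤ 2 * m * y) :
    1 / (8 * root4 y ^ 3) ≤ root4 m ^ 3 * (root4 (n + 1) - root4 n) := by
  set a := root4 (n + 1) with ha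
  set b := root4 n with hb
  have hb0 : 0 ≤ b := root4_nonneg n
  have hab : b ≤ a := root4_mono (by linarith)
  have ha0 : 0 < a := root4_pos (by linarith)
  have h1 : (a - b) * (a ^ 3 + a ^ 2 * b + a * b ^ 2 + b ^ 3) = 1 := by
    have e1 := root4_pow_four (x := n + 1) (by linarith)
    have e2 := root4_pow_four hn
    rw [← ha] at e1
    rw [← hb] at e2
    linear_combination e1 - e2
  have h2 : a ^ 3 + a ^ 2 * b + a * b ^ 2 + b ^ 3 ≤ 4 * a ^ 3 := by
    have : a ^ 2 * b ≤ a ^ 2 * a := by gcongr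
    have : a * b ^ 2 ≤ a * a ^ 2 := by gcongr
    have : b ^ 3 ≤ a ^ 3 := by gcongr
    nlinarith
  have h3 : 1 ≤ (a - b) * (4 * a ^ 3) := by
    rw [← h1]
    exact mul_le_mul_of_nonneg_left h2 (sub_nonneg.2 hab)
  have h4 : a ^ 3 ≤ 2 * root4 m ^ 3 * root4 y ^ 3 := by
    have e : root4 (2 * m * y) = root4 2 * root4 m * root4 y := by
      rw [root4_mul (by positivity), root4_mul (by norm_num)]
    have h5 : a ≤ root4 2 * root4 m * root4 y := by rw [← e]; exact root4_mono h
    have := root4_nonneg m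
    have := root4_nonneg y
    calc a ^ 3 ≤ (root4 2 * root4 m * root4 y) ^ 3 := by gcongr
      _ = root4 2 ^ 3 * root4 m ^ 3 * root4 y ^ 3 := by ring
      _ ≤ _ := by gcongr; exact root4_two_pow_three_le
  have hy' := root4_pos hy
  rw [div_le_iff₀ (by positivity)]
  have h6 : (a - b) * (4 * a ^ 3) ≤ (a - b) * (4 * (2 * root4 m ^ 3 * root4 y ^ 3)) :=
    mul_le_mul_of_nonneg_left (by linarith) (sub_nonneg.2 hab)
  linarith

/-- The potential that pays for the viewed items. -/
def potential (s : Counts N) : ℝ := ∑ i, root4 (s.views i) + root4 N ^ 3 * root4 s.stays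

/-- The widths use the counters `s₀` frozen at the start of the round, while the potential moves
with the current counters `s`. An item is viewed at most once per round, so its counter is still the
frozen one when it is viewed. The abandonment counter may grow by `N` within a round, which is why
its root has weight `N^(3/4)` in the potential. -/
lemma potential_add_viewSum_le {u : Fin N → ℝ} {q : ℝ} (hu : ∀ i, u i ∈ Set.Icc (0 : ℝ) 1)
    (hq : q ∈ Set.Icc (0 : ℝ) 1) {s₀ : Counts N} (hv : ∀ i, 1 ≤ s₀.views i) (hs : 1 ≤ s₀.stays)
    {S : List (Fin N)} (hS : S.Nodup) (s : Counts N) (h1 : ∀ i ∈ S, s.views i = s₀.views i)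
    (h2 : s.stays + S.length ≤ s₀.stays + N) :
    potential s + viewSum u q (fun i => 1 / (8 * root4 (s₀.views i) ^ 3))
        (1 / (8 * root4 s₀.stays ^ 3)) S
      ≤ expFeedback u q S (fun m => potential (s.updateAll m)) := by
  induction S generalizing s with
  | nil => simp [viewSum, expFeedback, Counts.updateAll]
  | cons i l ih =>
    set g : Fin N → ℝ := fun i => 1 / (8 * root4 (s₀.views i) ^ 3) with hg
    set g' : ℝ := 1 / (8 * root4 s₀.stays ^ 3) with hg'
    have hN : 1 ≤ N := by have := i.2; omega
    have a1 : ∀ ρ, ∑ j, root4 (s.views j) + g i ≤ ∑ j, root4 ((s.update (i, ρ)).views j) := by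
      intro ρ
      have hstep : g i ≤ root4 ((s.views i : ℝ) + 1) - root4 (s.views i) := by
        have := one_div_le_root4_sub (n := s.views i) (m := 1) (y := s₀.views i)
          (Nat.cast_nonneg _) one_pos (by exact_mod_cast hv i) (by
            rw [h1 i (by simp)]
            have : (1 : ℝ) ≤ s₀.views i := by exact_mod_cast hv i
            linarith)
        rw [root4_one, one_pow, one_mul] at this
        exact this
      have e : ∑ j, root4 ((s.update (i, ρ)).views j)
          = ∑ j, (root4 (s.views j)
            + if j = i then root4 ((s.views i : ℝ) + 1) - root4 (s.views i) else 0) := by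
        refine Finset.sum_congr rfl fun j _ => ?_
        rw [views_update]
        by_cases hj : j = i
        · subst hj; simp
        · simp [hj]
      rw [e, Finset.sum_add_distrib, Finset.sum_ite_eq' Finset.univ i]
      simpa using hstep
    -- With `y = s₀.stays`, the reserve in `h2` gives `n + 1 ≤ y + N ≤ 2 N y`.
    have a2 : root4 N ^ 3 * root4 s.stays + g' ≤ root4 N ^ 3 * root4 ((s.stays : ℝ) + 1) := by
      have := one_div_le_root4_sub (n := s.stays) (m := N) (y := s₀.stays)
        (Nat.cast_nonneg _) (by exact_mod_cast hN) (by exact_mod_cast hs) (by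
          have b1 : (s.stays : ℝ) + 1 ≤ s₀.stays + N := by
            rw [List.length_cons] at h2
            exact_mod_cast (by omega : s.stays + 1 ≤ s₀.stays + N)
          have b2 : (1 : ℝ) ≤ s₀.stays := by exact_mod_cast hs
          have b3 : (1 : ℝ) ≤ N := by exact_mod_cast hN
          nlinarith)
      rw [mul_sub] at this
      linarith
    have c1 : potential s + g i ≤ potential (s.update (i, Reaction.select)) := by
      simp only [potential, stays_update_select]
      linarith [a1 Reaction.select]
    have c2 : potential s + g i + g' ≤ potential (s.update (i, Reaction.abandon)) := by
      simp only [potential, stays_update_abandon, Nat.cast_add, Nat.cast_one]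
      linarith [a1 Reaction.abandon]
    have c3 : potential s + g i + g' ≤ potential (s.update (i, Reaction.continue)) := by
      simp only [potential, stays_update_continue, Nat.cast_add, Nat.cast_one]
      linarith [a1 Reaction.continue]
    have c4 := ih (List.nodup_cons.1 hS).2 (s.update (i, Reaction.continue))
      (fun j hj => by
        have : j ≠ i := fun h => (List.nodup_cons.1 hS).1 (h ▸ hj)
        rw [views_update, if_neg this, add_zero, h1 j (by simp [hj])])
      (by rw [stays_update_continue]; rw [List.length_cons] at h2; omega)
    have d1 := (hu i).1
    have d2 := sub_nonneg.2 (hu i).2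
    have d3 := hq.1
    have d4 := sub_nonneg.2 hq.2
    calc _ = u i * (potential s + g i) + (1 - u i) * ((1 - q) * (potential s + g i + g')
          + q * (potential s + g i + g' + viewSum u q g g' l)) := by
          simp only [viewSum]; ring
      _ ≤ u i * potential (s.update (i, Reaction.select))
          + (1 - u i) * ((1 - q) * potential (s.update (i, Reaction.abandon))
          + q * expFeedback u q l
            (fun m => potential ((s.update (i, Reaction.continue)).updateAll m))) := by
          gcongr
          linarith
      _ = _ := rfl

/-! ### Deviations of the empirical means -/

/-- Squared normalized deviation of `a` successes and `b` failures from the probability `p`. -/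
def sqDev (p : ℝ) (a b : ℕ) : ℝ := (a - p * (a + b)) ^ 2 / (a + b)

/-- Exponential bound on all the deviations. -/
def devWeight (u : Fin N → ℝ) (q : ℝ) (s : Counts N) : ℝ :=
  ∑ i, Real.exp (3 / 2 * sqDev (u i) (s.sel i) (s.unsel i))
    + Real.exp (3 / 2 * sqDev q s.cont s.aband)

/-- A common bound on all the deviations. -/
def maxDev (u : Fin N → ℝ) (q : ℝ) (s : Counts N) : ℝ := √(2 / 3 * Real.log (devWeight u q s))

lemma sqDev_nonneg (p : ℝ) (a b : ℕ) : 0 ≤ sqDev p a b := by unfold sqDev; positivity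

lemma one_le_devWeight (u : Fin N → ℝ) (q : ℝ) (s : Counts N) : 1 ≤ devWeight u q s := by
  have h1 : 0 ≤ ∑ i, Real.exp (3 / 2 * sqDev (u i) (s.sel i) (s.unsel i)) :=
    Finset.sum_nonneg fun _ _ => (Real.exp_pos _).le
  have h2 : 1 ≤ Real.exp (3 / 2 * sqDev q s.cont s.aband) :=
    Real.one_le_exp (mul_nonneg (by norm_num) (sqDev_nonneg _ _ _))
  unfold devWeight
  linarith

lemma maxDev_nonneg (u : Fin N → ℝ) (q : ℝ) (s : Counts N) : 0 ≤ maxDev u q s :=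
  Real.sqrt_nonneg _

lemma maxDev_sq (u : Fin N → ℝ) (q : ℝ) (s : Counts N) :
    maxDev u q s ^ 2 = 2 / 3 * Real.log (devWeight u q s) :=
  Real.sq_sqrt (mul_nonneg (by norm_num) (Real.log_nonneg (one_le_devWeight u q s)))

/-- This identity is the reason for defining `maxDev` as a logarithm of a sum of exponentials and
not as a maximum: it dominates every deviation, yet its exponential is a sum that can be integrated
term by term. -/
lemma exp_maxDev_sq (u : Fin N → ℝ) (q : ℝ) (s : Counts N) :
    Real.exp (3 / 2 * maxDev u q s ^ 2) = devWeight u q s := by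
  rw [maxDev_sq, ← mul_assoc, show (3 : ℝ) / 2 * (2 / 3) = 1 by norm_num, one_mul,
    Real.exp_log (by linarith [one_le_devWeight u q s])]

lemma sqDev_item_le (u : Fin N → ℝ) (q : ℝ) (s : Counts N) (i : Fin N) :
    sqDev (u i) (s.sel i) (s.unsel i) ≤ maxDev u q s ^ 2 := by
  have h1 : Real.exp (3 / 2 * sqDev (u i) (s.sel i) (s.unsel i)) ≤ devWeight u q s := by
    unfold devWeight
    have := Finset.single_le_sum
      (f := fun i => Real.exp (3 / 2 * sqDev (u i) (s.sel i) (s.unsel i)))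
      (fun _ _ => (Real.exp_pos _).le) (Finset.mem_univ i)
    linarith [Real.exp_pos (3 / 2 * sqDev q s.cont s.aband)]
  rw [← exp_maxDev_sq, Real.exp_le_exp] at h1
  linarith

lemma sqDev_stay_le (u : Fin N → ℝ) (q : ℝ) (s : Counts N) :
    sqDev q s.cont s.aband ≤ maxDev u q s ^ 2 := by
  have h1 : Real.exp (3 / 2 * sqDev q s.cont s.aband) ≤ devWeight u q s := by
    unfold devWeight
    have : 0 ≤ ∑ i, Real.exp (3 / 2 * sqDev (u i) (s.sel i) (s.unsel i)) :=
      Finset.sum_nonneg fun _ _ => (Real.exp_pos _).le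
    linarith
  rw [← exp_maxDev_sq, Real.exp_le_exp] at h1
  linarith

lemma exp_sqDev_le {p : ℝ} (hp : p ∈ Set.Icc (0 : ℝ) 1) {a b K : ℕ} (h : 0 < a + b)
    (hK : a + b ≤ 4 ^ K) :
    Real.exp (3 / 2 * sqDev p a b) ≤ Real.exp (3 / 2)
      + ∑ k ∈ Finset.range K, (expWeight p (2 / 2 ^ k) a b + expWeight p (-(2 / 2 ^ k)) a b) := by
  have h' : (0 : ℝ) < a + b := by exact_mod_cast h
  refine exp_sq_div_le_sum h' ?_ (by exact_mod_cast hK)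
  have := hp.1
  have := hp.2
  have : (0 : ℝ) ≤ a := Nat.cast_nonneg a
  have : (0 : ℝ) ≤ b := Nat.cast_nonneg b
  rw [abs_le]
  constructor <;> nlinarith

/-! ### The samples -/

lemma toUnit_mem_Icc (x : ℝ) : toUnit x ∈ Set.Icc (0 : ℝ) 1 :=
  ⟨le_max_left _ _, max_le zero_le_one (min_le_left _ _)⟩

lemma abs_toUnit_sub_le {p : ℝ} (hp : p ∈ Set.Icc (0 : ℝ) 1) (x : ℝ) :
    |toUnit x - p| ≤ |x - p| := by
  have e : toUnit p = p := by rw [toUnit, min_eq_right hp.2, max_eq_right hp.1]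
  conv_lhs => rw [← e]
  unfold toUnit
  refine (abs_max_sub_max_le_max _ _ _ _).trans ?_
  rw [sub_self, abs_zero, max_eq_right (abs_nonneg _)]
  refine (abs_min_sub_min_le_max _ _ _ _).trans ?_
  rw [sub_self, abs_zero, max_eq_right (abs_nonneg _)]

lemma le_toUnit {p x : ℝ} (hp : p ≤ 1) (h : p ≤ x) : p ≤ toUnit x :=
  le_max_of_le_right (le_min hp h)

lemma abs_postMean_sub_le {p d : ℝ} (hd : 0 ≤ d) {a b : ℕ} (h : 0 < a + b)
    (hdev : sqDev p a b ≤ d ^ 2) : |postMean a b - p| ≤ d / √(a + b) := by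
  have h' : (0 : ℝ) < a + b := by exact_mod_cast h
  have hs := Real.sqrt_pos.2 h'
  refine abs_le_of_sq_le_sq ?_ (by positivity)
  rw [div_pow, Real.sq_sqrt h'.le]
  have e : (postMean a b - p) ^ 2 = sqDev p a b / (a + b) := by
    rw [postMean, sqDev]; field_simp
  rw [e]
  gcongr

lemma postMean_mem_Icc (a b : ℕ) : postMean a b ∈ Set.Icc (0 : ℝ) 1 := by
  unfold postMean
  exact ⟨by positivity, div_le_one_of_le₀ (by linarith [(Nat.cast_nonneg b : (0 : ℝ) ≤ b)])
    (by positivity)⟩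

lemma postStd_nonneg (α β : ℝ) (a b : ℕ) : 0 ≤ postStd α β a b := by
  unfold postStd; positivity

lemma sqrt_div_le_postStd (α : ℝ) {β : ℝ} (hβ : 0 ≤ β) (a b : ℕ) :
    √β / √(a + b) ≤ postStd α β a b := by
  rw [← Real.sqrt_div hβ]
  unfold postStd
  have := Real.sqrt_nonneg
    (α * postMean a b * (1 - postMean a b) / ((a : ℝ) + (b : ℝ) + 1))
  linarith

lemma postStd_le {α β : ℝ} (hα : 0 ≤ α) (hβ : 0 ≤ β) {a b : ℕ} (h : 0 < a + b) :
    postStd α β a b ≤ (√α + √β) / √(a + b) := by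
  have h' : (0 : ℝ) < a + b := by exact_mod_cast h
  obtain ⟨h1, h2⟩ := postMean_mem_Icc a b
  rw [add_div, ← Real.sqrt_div hα, ← Real.sqrt_div hβ]
  unfold postStd
  have h3 : postMean a b * (1 - postMean a b) ≤ 1 := by nlinarith
  have : α * postMean a b * (1 - postMean a b) ≤ α := by
    rw [mul_assoc]; exact mul_le_of_le_one_right hα h3
  exact add_le_add (Real.sqrt_le_sqrt (div_le_div₀ hα this h' (by linarith))) le_rfl

section samples

variable {R : ℕ} {α β : ℝ}

lemma le_maxSample (α β : ℝ) (θ : Fin R → ℝ) (a b : ℕ) (j : Fin R) :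
    postMean a b + θ j * postStd α β a b ≤ maxSample α β θ a b :=
  le_ciSup (f := fun j : Fin R => postMean a b + θ j * postStd α β a b)
    (Set.finite_range _).bddAbove j

lemma abs_maxSample_sub_le [NeZero R] (α β : ℝ) (θ : Fin R → ℝ) (a b : ℕ) :
    |maxSample α β θ a b - postMean a b| ≤ ‖θ‖ * postStd α β a b := by
  have hs := postStd_nonneg α β a b
  have hθ (j : Fin R) : |θ j| ≤ ‖θ‖ := norm_le_pi_norm θ j
  rw [abs_le]
  constructor
  · have h1 := le_maxSample α β θ a b 0
    have h2 := neg_le_of_abs_le (hθ 0)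
    nlinarith
  · have : maxSample α β θ a b ≤ postMean a b + ‖θ‖ * postStd α β a b := by
      refine ciSup_le fun j => ?_
      have := (abs_le.1 (hθ j)).2
      gcongr
    linarith

lemma abs_toUnit_maxSample_sub_le [NeZero R] (hα : 0 ≤ α) (hβ : 0 ≤ β) {p d : ℝ}
    (hp : p ∈ Set.Icc (0 : ℝ) 1) (hd : 0 ≤ d) {a b : ℕ} (h : 0 < a + b)
    (hdev : sqDev p a b ≤ d ^ 2) (θ : Fin R → ℝ) :
    |toUnit (maxSample α β θ a b) - p| ≤ (d + (√α + √β) * ‖θ‖) * (1 / √(a + b)) := by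
  have h1 := abs_postMean_sub_le hd h hdev
  have h2 := abs_maxSample_sub_le α β θ a b
  have h3 : ‖θ‖ * postStd α β a b ≤ ‖θ‖ * ((√α + √β) / √(a + b)) := by
    gcongr
    exact postStd_le hα hβ h
  have h4 := abs_add_le (maxSample α β θ a b - postMean a b) (postMean a b - p)
  rw [sub_add_sub_cancel] at h4
  calc _ ≤ |maxSample α β θ a b - p| := abs_toUnit_sub_le hp _
    _ ≤ ‖θ‖ * ((√α + √β) / √(a + b)) + d / √(a + b) := by linarith
    _ = _ := by ring

/-- The deviation is at most `d/√n`, and the `β` term makes the standard deviation at least `√β/√n`.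
The threshold `d/√β` therefore does not depend on the counters, so one coordinate serves all
parameters at once. -/
lemma le_toUnit_maxSample (hβ : 0 < β) {p d : ℝ} (hp : p ≤ 1) (hd : 0 ≤ d) {a b : ℕ}
    (h : 0 < a + b) (hdev : sqDev p a b ≤ d ^ 2) {θ : Fin R → ℝ} {j : Fin R}
    (hθ : d / √β ≤ θ j) : p ≤ toUnit (maxSample α β θ a b) := by
  refine le_toUnit hp (le_trans ?_ (le_maxSample α β θ a b j))
  have h' : (0 : ℝ) < a + b := by exact_mod_cast h
  have h1 := neg_le_of_abs_le (abs_postMean_sub_le hd h hdev)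
  have hb := Real.sqrt_pos.2 hβ
  have h2 : d / √(a + b) ≤ θ j * postStd α β a b := by
    calc d / √(a + b) = d / √β * (√β / √(a + b)) := by field_simp
      _ ≤ θ j * postStd α β a b := by
        have h0 : 0 ≤ d / √β := by positivity
        have := sqrt_div_le_postStd α hβ.le a b
        have := postStd_nonneg α β a b
        gcongr
        exact h0.trans hθ
  linarith

end samples

/-! ### Gaussian samples -/

/-- The density is integrated over `[x, x + 1]` only. Enlarging the exponent `1/2` to `2/3` absorbs
the shift and leaves a bound without a polynomial factor. -/
lemma le_gaussianReal_Ici (x : ℝ) :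
    (√(2 * Real.pi) * Real.exp 2)⁻¹ * Real.exp (-(2 / 3 * x ^ 2))
      ≤ (gaussianReal 0 1).real (Set.Ici x) := by
  have h1 : ∫ y in Set.Icc x (x + 1), gaussianPDFReal 0 1 y
      ≤ (gaussianReal 0 1).real (Set.Ici x) := by
    rw [measureReal_def, gaussianReal_apply_eq_integral _ one_ne_zero,
      ENNReal.toReal_ofReal (integral_nonneg fun y => gaussianPDFReal_nonneg _ _ _)]
    exact setIntegral_mono_set (integrable_gaussianPDFReal 0 1).integrableOn
      (Filter.Eventually.of_forall fun y => gaussianPDFReal_nonneg _ _ _)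
      (Filter.Eventually.of_forall fun y hy => hy.1)
  refine le_trans ?_ h1
  have h2 : ∫ y in Set.Icc x (x + 1),
      (√(2 * Real.pi) * Real.exp 2)⁻¹ * Real.exp (-(2 / 3 * x ^ 2))
      ≤ ∫ y in Set.Icc x (x + 1), gaussianPDFReal 0 1 y := by
    refine setIntegral_mono_on (integrableOn_const (by simp)) (integrable_gaussianPDFReal 0 1).integrableOn
      measurableSet_Icc fun y hy => ?_
    rw [gaussianPDFReal, mul_inv, mul_assoc, ← Real.exp_neg, ← Real.exp_add]
    simp only [NNReal.coe_one, mul_one, sub_zero]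
    gcongr
    obtain ⟨h3, h4⟩ := hy
    -- The constant `2` comes from `2 + 2x²/3 - (x + 1)²/2 = (x - 3)²/6`.
    nlinarith [sq_nonneg (x - 3)]
  simpa using h2

/-! ### Moments of the largest absolute value among `R` standard Gaussians. -/

section norm

variable {R : ℕ}

/-- The law of the samples of a round. -/
abbrev sampleLaw (R : ℕ) : Measure (Fin R → ℝ) := Measure.pi fun _ => gaussianReal 0 1

lemma le_sampleLaw (x : ℝ) (j : Fin R) :
    (√(2 * Real.pi) * Real.exp 2)⁻¹ * Real.exp (-(2 / 3 * x ^ 2))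
      ≤ (sampleLaw R).real {θ | x ≤ θ j} := by
  refine (le_gaussianReal_Ici x).trans_eq ?_
  have := (measurePreserving_eval (fun _ : Fin R => gaussianReal 0 1) j).measure_preimage
    (measurableSet_Ici (a := x)).nullMeasurableSet
  rw [measureReal_def, ← this]
  rfl

/-- The order of magnitude of the largest sample. -/
def sampleScale (R : ℕ) : ℝ := √(2 * Real.log (2 * R))

lemma one_le_sampleScale (hR : 1 ≤ R) : 1 ≤ sampleScale R := by
  rw [sampleScale, Real.one_le_sqrt]
  have h1 : Real.log 2 ≤ Real.log (2 * R) := by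
    refine Real.log_le_log (by norm_num) ?_
    have : (1 : ℝ) ≤ R := by exact_mod_cast hR
    linarith
  linarith [Real.log_two_gt_d9]

lemma exp_mul_norm_le [NeZero R] {t : ℝ} (θ : Fin R → ℝ) :
    Real.exp (t * ‖θ‖) ≤ ∑ j, (Real.exp (t * θ j) + Real.exp (-t * θ j)) := by
  obtain ⟨j, hj⟩ : ∃ j, ‖θ‖ = ‖θ j‖ := by
    obtain ⟨j, hj⟩ := Finite.exists_max fun j => ‖θ j‖
    exact ⟨j, le_antisymm ((pi_norm_le_iff_of_nonneg (norm_nonneg _)).2 hj) (norm_le_pi_norm θ j)⟩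
  refine le_trans ?_ (Finset.single_le_sum
    (f := fun j => Real.exp (t * θ j) + Real.exp (-t * θ j))
    (fun _ _ => add_nonneg (Real.exp_pos _).le (Real.exp_pos _).le) (Finset.mem_univ j))
  rw [hj, Real.norm_eq_abs]
  rcases abs_cases (θ j) with ⟨h, -⟩ | ⟨h, -⟩ <;> rw [h]
  · exact le_add_of_nonneg_right (Real.exp_pos _).le
  · rw [mul_neg, ← neg_mul]
    exact le_add_of_nonneg_left (Real.exp_pos _).le

lemma integrable_exp_mul_eval (t : ℝ) (j : Fin R) :
    Integrable (fun θ : Fin R → ℝ => Real.exp (t * θ j)) (sampleLaw R) ∧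
      ∫ θ, Real.exp (t * θ j) ∂(sampleLaw R) = Real.exp (t ^ 2 / 2) := by
  have hmp := measurePreserving_eval (fun _ : Fin R => gaussianReal 0 1) j
  have h1 : Integrable (fun x : ℝ => Real.exp (t * x)) (gaussianReal 0 1) :=
    integrable_exp_mul_gaussianReal t
  have h2 : ∫ x, Real.exp (t * x) ∂(gaussianReal 0 1) = Real.exp (t ^ 2 / 2) := by
    have := congr_fun (mgf_id_gaussianReal (μ := 0) (v := 1)) t
    simpa [mgf] using this
  refine ⟨hmp.integrable_comp_of_integrable h1, ?_⟩
  rw [← h2, ← hmp.map_eq, integral_map hmp.measurable.aemeasurable (by fun_prop)]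

lemma integral_exp_mul_norm_le [NeZero R] (t : ℝ) :
    Integrable (fun θ : Fin R → ℝ => Real.exp (t * ‖θ‖)) (sampleLaw R) ∧
      ∫ θ, Real.exp (t * ‖θ‖) ∂(sampleLaw R) ≤ 2 * R * Real.exp (t ^ 2 / 2) := by
  have h1 : Integrable (fun θ : Fin R → ℝ => ∑ j, (Real.exp (t * θ j) + Real.exp (-t * θ j)))
      (sampleLaw R) := integrable_finsetSum _ fun j _ =>
    (integrable_exp_mul_eval t j).1.add (integrable_exp_mul_eval (-t) j).1
  have h2 : Integrable (fun θ : Fin R → ℝ => Real.exp (t * ‖θ‖)) (sampleLaw R) := by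
    refine h1.mono' (by fun_prop) (Filter.Eventually.of_forall fun θ => ?_)
    rw [Real.norm_eq_abs, abs_of_pos (Real.exp_pos _)]
    exact exp_mul_norm_le θ
  refine ⟨h2, (integral_mono h2 h1 fun θ => exp_mul_norm_le θ).trans_eq ?_⟩
  have hsum := integral_finsetSum (μ := sampleLaw R) Finset.univ
    (f := fun j θ => Real.exp (t * θ j) + Real.exp (-t * θ j)) fun j _ =>
    (integrable_exp_mul_eval t j).1.add (integrable_exp_mul_eval (-t) j).1
  rw [hsum]
  have (j : Fin R) : ∫ θ : Fin R → ℝ, (Real.exp (t * θ j) + Real.exp (-t * θ j)) ∂(sampleLaw R)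
      = 2 * Real.exp (t ^ 2 / 2) := by
    rw [integral_add (integrable_exp_mul_eval t j).1 (integrable_exp_mul_eval (-t) j).1,
      (integrable_exp_mul_eval t j).2, (integrable_exp_mul_eval (-t) j).2]
    ring_nf
  simp only [this, Finset.sum_const, Finset.card_univ, Fintype.card_fin, nsmul_eq_mul]
  ring

/-- A union bound gives `2R exp(L²/2)` for the exponential moment at `L`, and the scale `L` is
chosen so that `exp(L²/2) = 2R`. Thus the excess of the norm over `L` has a moment bound free of
`R`, from which the first and third moments follow. -/
lemma integral_exp_scale_le [NeZero R] :
    Integrable (fun θ : Fin R → ℝ => Real.exp (sampleScale R * (‖θ‖ - sampleScale R)))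
        (sampleLaw R) ∧
      ∫ θ, Real.exp (sampleScale R * (‖θ‖ - sampleScale R)) ∂(sampleLaw R) ≤ 1 := by
  set L := sampleScale R with hL
  have hR : 1 ≤ R := NeZero.one_le
  obtain ⟨h1, h2⟩ := integral_exp_mul_norm_le (R := R) L
  have e (θ : Fin R → ℝ) : Real.exp (L * (‖θ‖ - L)) = Real.exp (-L ^ 2) * Real.exp (L * ‖θ‖) := by
    rw [← Real.exp_add]; ring_nf
  simp only [e]
  refine ⟨h1.const_mul _, ?_⟩
  have h3 : 0 < 2 * (R : ℝ) := by
    have : (1 : ℝ) ≤ R := by exact_mod_cast hR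
    linarith
  have h4 : Real.exp (L ^ 2 / 2) = 2 * R := by
    rw [hL, sampleScale, Real.sq_sqrt (mul_nonneg (by norm_num) (Real.log_nonneg (by
      have : (1 : ℝ) ≤ R := by exact_mod_cast hR
      linarith))), mul_div_cancel_left₀ _ (by norm_num), Real.exp_log h3]
  rw [integral_const_mul]
  calc _ ≤ Real.exp (-L ^ 2) * (2 * R * Real.exp (L ^ 2 / 2)) := by gcongr
    _ = 1 := by rw [← h4, ← Real.exp_add, ← Real.exp_add]; ring_nf; simp

lemma norm_le_scale {x L : ℝ} (hL : 1 ≤ L) : x ≤ L + Real.exp (L * (x - L)) := by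
  rcases le_total x L with h | h
  · linarith [Real.exp_pos (L * (x - L))]
  · have := Real.add_one_le_exp (L * (x - L))
    nlinarith

lemma norm_pow_three_le_scale {x L : ℝ} (hx : 0 ≤ x) (hL : 1 ≤ L) :
    x ^ 3 ≤ 4 * L ^ 3 + 24 * Real.exp (L * (x - L)) := by
  have hL3 : 0 ≤ L ^ 3 := by positivity
  rcases le_total x L with h | h
  · have : x ^ 3 ≤ L ^ 3 := by gcongr
    linarith [Real.exp_pos (L * (x - L))]
  · set y := x - L with hy
    have hy0 : 0 ≤ y := sub_nonneg.2 h
    have h1 : y ^ 3 / 6 ≤ Real.exp y := by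
      have := Real.pow_div_factorial_le_exp y hy0 3
      simpa [Nat.factorial] using this
    have h2 : Real.exp y ≤ Real.exp (L * y) := Real.exp_le_exp.2 (by nlinarith)
    have h3 : x ^ 3 ≤ 4 * L ^ 3 + 4 * y ^ 3 := by
      have e : x = L + y := by rw [hy]; ring
      rw [e]
      nlinarith [mul_nonneg (add_nonneg (zero_le_one.trans hL) hy0) (sq_nonneg (L - y))]
    linarith

lemma integral_norm_le [NeZero R] :
    Integrable (fun θ : Fin R → ℝ => ‖θ‖) (sampleLaw R) ∧
      ∫ θ, ‖θ‖ ∂(sampleLaw R) ≤ 2 * sampleScale R := by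
  have hL := one_le_sampleScale (R := R) NeZero.one_le
  obtain ⟨h1, h2⟩ := integral_exp_scale_le (R := R)
  have h3 := (integrable_const (μ := sampleLaw R) (sampleScale R)).add h1
  have h4 : Integrable (fun θ : Fin R → ℝ => ‖θ‖) (sampleLaw R) := by
    refine h3.mono' (by fun_prop) (Filter.Eventually.of_forall fun θ => ?_)
    rw [norm_norm]
    exact norm_le_scale hL
  refine ⟨h4, (integral_mono h4 h3 fun θ => norm_le_scale hL).trans ?_⟩
  simp only [Pi.add_apply]
  rw [integral_add (integrable_const _) h1]
  simp
  linarith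

lemma integral_norm_pow_three_le [NeZero R] :
    Integrable (fun θ : Fin R → ℝ => ‖θ‖ ^ 3) (sampleLaw R) ∧
      ∫ θ, ‖θ‖ ^ 3 ∂(sampleLaw R) ≤ 28 * sampleScale R ^ 3 := by
  have hL := one_le_sampleScale (R := R) NeZero.one_le
  obtain ⟨h1, h2⟩ := integral_exp_scale_le (R := R)
  have h3 := (integrable_const (μ := sampleLaw R) (4 * sampleScale R ^ 3)).add (h1.const_mul 24)
  have hle (θ : Fin R → ℝ) := norm_pow_three_le_scale (norm_nonneg θ) hL
  have h4 : Integrable (fun θ : Fin R → ℝ => ‖θ‖ ^ 3) (sampleLaw R) := by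
    refine h3.mono' (by fun_prop) (Filter.Eventually.of_forall fun θ => ?_)
    rw [norm_pow, norm_norm]
    exact hle θ
  refine ⟨h4, (integral_mono h4 h3 hle).trans ?_⟩
  simp only [Pi.add_apply]
  rw [integral_add (integrable_const _) (h1.const_mul 24), integral_const, integral_const_mul]
  have : (1 : ℝ) ≤ sampleScale R ^ 3 := one_le_pow₀ hL
  simp
  linarith

end norm

/-! ### Integrals over finite partitions -/

/-- In a given round the counters and the offered sequence take finitely many values. Conditioning
on them is thus a finite sum over events. -/
lemma integral_comp_finite_range {Ω κ : Type*} [MeasurableSpace Ω] {μ : Measure Ω} {Y : Ω → κ}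
    (hfin : (Set.range Y).Finite) (hY : ∀ s, MeasurableSet {ω | Y ω = s}) {f : κ → Ω → ℝ}
    (hf : ∀ s, IntegrableOn (f s) {ω | Y ω = s} μ) :
    Integrable (fun ω => f (Y ω) ω) μ ∧
      ∫ ω, f (Y ω) ω ∂μ = ∑ s ∈ hfin.toFinset, ∫ ω in {ω | Y ω = s}, f s ω ∂μ := by
  have e : (fun ω => f (Y ω) ω)
      = fun ω => ∑ s ∈ hfin.toFinset, {ω | Y ω = s}.indicator (f s) ω := by
    ext ω
    rw [Finset.sum_eq_single_of_mem (Y ω) (by simp)]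
    · rw [Set.indicator_of_mem (by simp)]
    · intro s _ hs
      exact Set.indicator_of_notMem (fun h => hs h.symm) _
  have h (s : κ) : Integrable ({ω | Y ω = s}.indicator (f s)) μ :=
    (integrable_indicator_iff (hY s)).2 (hf s)
  rw [e]
  refine ⟨integrable_finsetSum _ fun s _ => h s, ?_⟩
  rw [integral_finsetSum _ fun s _ => h s]
  exact Finset.sum_congr rfl fun s _ => integral_indicator (hY s)

lemma integrable_of_finite_range {Ω κ : Type*} [MeasurableSpace Ω] {μ : Measure Ω}
    [IsFiniteMeasure μ] {Y : Ω → κ} (hfin : (Set.range Y).Finite)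
    (hY : ∀ s, MeasurableSet {ω | Y ω = s}) (f : κ → ℝ) : Integrable (fun ω => f (Y ω)) μ :=
  (integral_comp_finite_range hfin hY (f := fun s _ => f s)
    fun _ => integrableOn_const (measure_ne_top _ _)).1

/-! ### Measurability of the state -/

lemma Counts.injective_fields :
    Function.Injective fun s : Counts N => (s.sel, s.unsel, s.cont, s.aband) := by
  rintro ⟨a, b, c, d⟩ ⟨a', b', c', d'⟩ h
  simpa using h

instance : Countable (Counts N) := Counts.injective_fields.countable

lemma Counts.finite_setOf_le (B : ℕ) :
    {s : Counts N | (∀ i, s.views i ≤ B) ∧ s.stays ≤ B}.Finite := by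
  refine Set.Finite.of_finite_image (f := fun s : Counts N => (s.sel, s.unsel, s.cont, s.aband))
    (((Set.finite_Iic fun _ : Fin N => B).prod ((Set.finite_Iic fun _ : Fin N => B).prod
      ((Set.finite_Iic B).prod (Set.finite_Iic B)))).subset ?_) Counts.injective_fields.injOn
  rintro _ ⟨s, ⟨h1, h2⟩, rfl⟩
  simp only [Counts.views, Counts.stays] at h1 h2
  refine ⟨fun i => ?_, fun i => ?_, ?_, ?_⟩
  · have := h1 i; simp only; omega
  · have := h1 i; simp only; omega
  · change s.cont ≤ B; omega
  · change s.aband ≤ B; omega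

namespace Run

variable {α β : ℝ} {R : ℕ} {r : Fin N → ℝ} {c : ℝ} {u : Fin N → ℝ} {q : ℝ}
  {Ω : Type*} [mΩ : MeasurableSpace Ω] {μ : Measure Ω}

/-- Counters at the beginning of round `t`. -/
def state (X : Run α β R r c u q μ) (t : ℕ) (ω : Ω) : Counts N :=
  counts (fun m => X.seq m ω) (fun m => X.click m ω) (fun m => X.patience m ω) t

variable (X : Run α β R r c u q μ)

lemma state_succ (t : ℕ) (ω : Ω) : X.state (t + 1) ω
    = (X.state t ω).updateAll (feedback (X.click t ω) (X.patience t ω) (X.seq t ω)) := rfl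

lemma nodup_seq (t : ℕ) (ω : Ω) : (X.seq t ω).Nodup := (X.optimal t ω).1

lemma two_le_views_state (t : ℕ) (ω : Ω) (i : Fin N) : 2 ≤ (X.state t ω).views i :=
  two_le_views_counts _ _ _ t i

lemma two_le_stays_state (t : ℕ) (ω : Ω) : 2 ≤ (X.state t ω).stays :=
  two_le_stays_counts _ _ _ t

lemma views_state_le (t : ℕ) (ω : Ω) (i : Fin N) : (X.state t ω).views i ≤ t + 2 :=
  views_counts_le _ _ _ (fun m => X.nodup_seq m ω) t i

lemma stays_state_le (t : ℕ) (ω : Ω) : (X.state t ω).stays ≤ N * t + 2 :=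
  stays_counts_le _ _ _ (fun m => X.nodup_seq m ω) t

lemma finite_range_state (t : ℕ) : (Set.range (X.state t)).Finite := by
  refine (Counts.finite_setOf_le (N := N) (t + N * t + 2)).subset ?_
  rintro _ ⟨ω, rfl⟩
  exact ⟨fun i => (X.views_state_le t ω i).trans (by omega),
    (X.stays_state_le t ω).trans (by omega)⟩

lemma finite_range_seq (t : ℕ) : (Set.range (X.seq t)).Finite := by
  have : Finite {S : List (Fin N) // S.Nodup} := inferInstance
  refine (Set.finite_coe_iff.1 this : {S : List (Fin N) | S.Nodup}.Finite).subset ?_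
  rintro _ ⟨ω, rfl⟩
  exact X.nodup_seq t ω

lemma finite_range_state_seq (t : ℕ) :
    (Set.range fun ω => (X.state t ω, X.seq t ω)).Finite := by
  refine ((X.finite_range_state t).prod (X.finite_range_seq t)).subset ?_
  rintro _ ⟨ω, rfl⟩
  exact ⟨⟨ω, rfl⟩, ⟨ω, rfl⟩⟩

lemma past_le (t : ℕ) : X.past t ≤ mΩ := (X.past_le_present t).trans (X.present_le t)

lemma measurableSet_state (t : ℕ) (s : Counts N) :
    MeasurableSet[X.past t] {ω | X.state t ω = s} := by
  induction t generalizing s with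
  | zero => exact @MeasurableSet.const _ (X.past 0) (Counts.init N = s)
  | succ t ih =>
    have e : {ω | X.state (t + 1) ω = s}
        = ⋃ p ∈ {p : Counts N × List (Fin N) × (Fin N → Bool) × ℕ∞ |
            p.1.updateAll (feedback p.2.2.1 p.2.2.2 p.2.1) = s},
          ({ω | X.state t ω = p.1} ∩ {ω | X.seq t ω = p.2.1})
            ∩ (X.click t ⁻¹' {p.2.2.1} ∩ X.patience t ⁻¹' {p.2.2.2}) := by
      ext ω
      simp only [Set.mem_ofPred_eq, Set.mem_iUnion, Set.mem_inter_iff, Set.mem_preimage,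
        Set.mem_singleton_iff, exists_prop, state_succ]
      constructor
      · exact fun h => ⟨(_, _, _, _), h, ⟨rfl, rfl⟩, rfl, rfl⟩
      · rintro ⟨p, h, ⟨h1, h2⟩, h3, h4⟩
        rw [h1, h2, h3, h4, h]
    rw [e]
    refine MeasurableSet.biUnion (Set.to_countable _) fun p _ => ?_
    refine MeasurableSet.inter (MeasurableSet.inter ?_ ?_) (MeasurableSet.inter ?_ ?_)
    · exact X.present_le_past t _ (X.past_le_present t _ (ih _))
    · exact X.present_le_past t _ (X.measurable_seq t _)
    · exact X.measurable_click t (MeasurableSet.singleton _)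
    · exact X.measurable_patience t (MeasurableSet.singleton _)

lemma measurableSet_state_seq (t : ℕ) (p : Counts N × List (Fin N)) :
    MeasurableSet[X.present t] {ω | (X.state t ω, X.seq t ω) = p} := by
  have e : {ω | (X.state t ω, X.seq t ω) = p}
      = {ω | X.state t ω = p.1} ∩ {ω | X.seq t ω = p.2} := by
    ext ω; simp [Prod.ext_iff]
  rw [e]
  exact (X.past_le_present t _ (X.measurableSet_state t _)).inter (X.measurable_seq t _)

lemma integrable_state_seq [IsFiniteMeasure μ] (t : ℕ) (f : Counts N → List (Fin N) → ℝ) :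
    Integrable (fun ω => f (X.state t ω) (X.seq t ω)) μ :=
  integrable_of_finite_range (X.finite_range_state_seq t)
    (fun p => X.present_le t _ (X.measurableSet_state_seq t p)) fun p => f p.1 p.2

lemma integrable_state [IsFiniteMeasure μ] (t : ℕ) (f : Counts N → ℝ) :
    Integrable (fun ω => f (X.state t ω)) μ :=
  X.integrable_state_seq t fun s _ => f s

/-! ### Integrating out the samples of a round -/

/-- Each event that fixes the counters lies in the past, of which the samples of the round are
independent. -/
lemma integral_state_sample [IsProbabilityMeasure μ] (t : ℕ) {f : Counts N → (Fin R → ℝ) → ℝ}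
    (hm : ∀ s, StronglyMeasurable (f s)) (hf : ∀ s, Integrable (f s) (sampleLaw R)) :
    Integrable (fun ω => f (X.state t ω) (X.θ t ω)) μ ∧
      ∫ ω, f (X.state t ω) (X.θ t ω) ∂μ
        = ∫ ω, (∫ θ, f (X.state t ω) θ ∂(sampleLaw R)) ∂μ := by
  have hθ : Measurable (X.θ t) := (X.measurable_θ t).mono (X.present_le t) le_rfl
  have hs (s : Counts N) : MeasurableSet {ω | X.state t ω = s} :=
    X.past_le t _ (X.measurableSet_state t s)
  have hint (s : Counts N) : Integrable (fun ω => f s (X.θ t ω)) μ := by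
    refine Integrable.comp_measurable ?_ hθ
    rw [X.law_θ t]
    exact hf s
  have h1 := integral_comp_finite_range (X.finite_range_state t) hs
    (f := fun s ω => f s (X.θ t ω)) fun s => (hint s).integrableOn
  have h2 := integral_comp_finite_range (μ := μ) (X.finite_range_state t) hs
    (f := fun s _ => ∫ θ, f s θ ∂(sampleLaw R)) fun s => integrableOn_const (measure_ne_top _ _)
  refine ⟨h1.1, ?_⟩
  rw [h1.2, h2.2]
  refine Finset.sum_congr rfl fun s _ => ?_
  have hcond : μ[fun ω => f s (X.θ t ω) | X.past t]
      =ᵐ[μ] fun _ => ∫ ω, f s (X.θ t ω) ∂μ := by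
    refine condExp_indep_eq (m₁ := MeasurableSpace.comap (X.θ t) inferInstance) hθ.comap_le
      (X.past_le t) ?_ (X.indep_θ t).symm
    exact (hm s).comp_measurable (comap_measurable _)
  rw [← setIntegral_condExp (X.past_le t) (hint s) (X.measurableSet_state t s),
    setIntegral_congr_ae (hs s) (hcond.mono fun ω h _ => h),
    show sampleLaw R = μ.map (X.θ t) from (X.law_θ t).symm,
    integral_map hθ.aemeasurable (hm s).aestronglyMeasurable]

/-! ### Integrating out the reactions of a user -/

/-- The law of the user is given for complete click patterns. Summing over those that vanish on `B`
factorizes, and each item outside `B` contributes `u j + (1 - u j) = 1`. -/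
lemma measureReal_unselected [IsProbabilityMeasure μ] (hu : ∀ i, u i ∈ Set.Icc (0 : ℝ) 1)
    (hq : 0 ≤ q) (t : ℕ) {A : Set Ω} (hA : MeasurableSet[X.present t] A) (B : Finset (Fin N))
    (k : ℕ) :
    μ.real (A ∩ {ω | (∀ j ∈ B, X.click t ω j = false) ∧ (k : ℕ∞) < X.patience t ω})
      = μ.real A * (∏ j ∈ B, (1 - u j)) * q ^ k := by
  have hclick : Measurable (X.click t) := (X.measurable_click t).mono (X.past_le _) le_rfl
  have hpat : Measurable (X.patience t) := (X.measurable_patience t).mono (X.past_le _) le_rfl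
  set P : Fin N → Finset Bool := fun j => if j ∈ B then {false} else Finset.univ with hP
  have e : A ∩ {ω | (∀ j ∈ B, X.click t ω j = false) ∧ (k : ℕ∞) < X.patience t ω}
      = ⋃ b ∈ Fintype.piFinset P, A ∩ {ω | X.click t ω = b ∧ (k : ℕ∞) < X.patience t ω} := by
    ext ω
    simp only [Set.mem_inter_iff, Set.mem_ofPred_eq, Set.mem_iUnion, exists_prop,
      Fintype.mem_piFinset, hP]
    constructor
    · rintro ⟨h1, h2, h3⟩
      refine ⟨X.click t ω, fun j => ?_, h1, rfl, h3⟩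
      by_cases hj : j ∈ B
      · simp [hj, h2 j hj]
      · simp [hj]
    · rintro ⟨b, h1, h2, rfl, h3⟩
      refine ⟨h2, fun j hj => ?_, h3⟩
      simpa [hj] using h1 j
  have hmeas (b : Fin N → Bool) :
      MeasurableSet (A ∩ {ω | X.click t ω = b ∧ (k : ℕ∞) < X.patience t ω}) :=
    (X.present_le t _ hA).inter ((hclick (MeasurableSet.singleton b)).inter
      (hpat (Set.to_countable (Set.Ioi (k : ℕ∞))).measurableSet))
  rw [e, measureReal_biUnion_finset ?_ fun b _ => hmeas b]
  · have h1 (b : Fin N → Bool) :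
        μ.real (A ∩ {ω | X.click t ω = b ∧ (k : ℕ∞) < X.patience t ω})
          = μ.real A * q ^ k * ∏ i, if b i = true then u i else 1 - u i := by
      rw [measureReal_def, X.law_user t A hA b k, ENNReal.toReal_mul, ENNReal.toReal_ofReal]
      · rw [measureReal_def]; ring
      · refine mul_nonneg (Finset.prod_nonneg fun i _ => ?_) (pow_nonneg hq k)
        split_ifs
        · exact (hu i).1
        · exact sub_nonneg.2 (hu i).2
    simp only [h1]
    rw [← Finset.mul_sum, ← Finset.prod_univ_sum P fun i b => if b = true then u i else 1 - u i]
    have h2 : ∏ i, ∑ b ∈ P i, (if b = true then u i else 1 - u i) = ∏ j ∈ B, (1 - u j) := by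
      rw [← Finset.prod_subset (Finset.subset_univ B)]
      · exact Finset.prod_congr rfl fun j hj => by simp [hP, hj]
      · intro j _ hj
        simp [hP, hj]
    rw [h2]
    ring
  · intro b _ b' _ hb
    refine Set.disjoint_left.2 fun ω h h' => hb ?_
    exact h.2.1.symm.trans h'.2.1

/-- `B` collects the items already viewed in vain and `k` counts the unselected views survived.
Distinctness of the items makes each new click a fresh factor. -/
lemma setIntegral_feedbackFrom [IsProbabilityMeasure μ] (hu : ∀ i, u i ∈ Set.Icc (0 : ℝ) 1)
    (hq : 0 ≤ q) (t : ℕ) {A : Set Ω} (hA : MeasurableSet[X.present t] A) {S : List (Fin N)}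
    (hS : S.Nodup) (B : Finset (Fin N)) (hB : ∀ i ∈ S, i ∉ B) (k : ℕ)
    (F : List (Fin N × Reaction) → ℝ) :
    IntegrableOn (fun ω => F (feedbackFrom (X.click t ω) (X.patience t ω) (k + 1) S))
        (A ∩ {ω | (∀ j ∈ B, X.click t ω j = false) ∧ (k : ℕ∞) < X.patience t ω}) μ ∧
      ∫ ω in A ∩ {ω | (∀ j ∈ B, X.click t ω j = false) ∧ (k : ℕ∞) < X.patience t ω},
          F (feedbackFrom (X.click t ω) (X.patience t ω) (k + 1) S) ∂μ
        = μ.real A * (∏ j ∈ B, (1 - u j)) * q ^ k * expFeedback u q S F := by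
  have hclick : Measurable (X.click t) := (X.measurable_click t).mono (X.past_le _) le_rfl
  have hpat : Measurable (X.patience t) := (X.measurable_patience t).mono (X.past_le _) le_rfl
  have hmeas (B : Finset (Fin N)) (k : ℕ) : MeasurableSet
      (A ∩ {ω | (∀ j ∈ B, X.click t ω j = false) ∧ (k : ℕ∞) < X.patience t ω}) := by
    refine (X.present_le t _ hA).inter (MeasurableSet.inter ?_ (hpat (Set.to_countable (Set.Ioi (k : ℕ∞))).measurableSet))
    have : {b : Fin N → Bool | ∀ j ∈ B, b j = false}.Finite := Set.toFinite _
    exact hclick this.measurableSet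
  induction S generalizing B k F with
  | nil =>
    simp only [feedbackFrom, expFeedback]
    refine ⟨integrableOn_const (measure_ne_top _ _), ?_⟩
    rw [setIntegral_const, X.measureReal_unselected hu hq t hA]
    rfl
  | cons i l ih =>
    have hi : i ∉ B := hB i (by simp)
    have hil := (List.nodup_cons.1 hS).1
    -- `E ⊇ E₁ ⊇ E₂`: item `i` is selected on `E \ E₁`, the user abandons after it on `E₁ \ E₂`, and
    -- goes on to the next item on `E₂`.
    set E := A ∩ {ω | (∀ j ∈ B, X.click t ω j = false) ∧ (k : ℕ∞) < X.patience t ω} with hE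
    set E₁ := A ∩ {ω | (∀ j ∈ insert i B, X.click t ω j = false)
      ∧ (k : ℕ∞) < X.patience t ω} with hE₁
    set E₂ := A ∩ {ω | (∀ j ∈ insert i B, X.click t ω j = false)
      ∧ ((k + 1 : ℕ) : ℕ∞) < X.patience t ω} with hE₂
    have hE₁m : MeasurableSet E₁ := hmeas _ _
    have hE₂m : MeasurableSet E₂ := hmeas _ _
    have hEm : MeasurableSet E := hmeas _ _
    have h21 : E₂ ⊆ E₁ := by
      rintro ω ⟨h1, h2, h3⟩
      exact ⟨h1, h2, lt_of_le_of_lt (by exact_mod_cast Nat.le_succ k) h3⟩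
    have h1E : E₁ ⊆ E := by
      rintro ω ⟨h1, h2, h3⟩
      exact ⟨h1, fun j hj => h2 j (Finset.mem_insert_of_mem hj), h3⟩
    have m0 := X.measureReal_unselected hu hq t hA B k
    have m1 := X.measureReal_unselected hu hq t hA (insert i B) k
    have m2 := X.measureReal_unselected hu hq t hA (insert i B) (k + 1)
    rw [Finset.prod_insert hi] at m1 m2
    obtain ⟨i2, j2⟩ := ih (List.nodup_cons.1 hS).2 (insert i B) (fun j hj => by
      rw [Finset.mem_insert, not_or]
      exact ⟨fun h => hil (h ▸ hj), hB j (by simp [hj])⟩) (k + 1)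
      (fun m => F ((i, Reaction.continue) :: m))
    rw [Finset.prod_insert hi] at j2
    set G := fun ω => F (feedbackFrom (X.click t ω) (X.patience t ω) (k + 1) (i :: l)) with hG
    have g0 : Set.EqOn G (fun _ => F [(i, Reaction.select)]) (E \ E₁) := by
      rintro ω ⟨⟨h1, h2, h3⟩, h4⟩
      have : X.click t ω i = true := by
        by_contra hcon
        refine h4 ⟨h1, fun j hj => ?_, h3⟩
        rcases Finset.mem_insert.1 hj with rfl | hj
        · simpa using hcon
        · exact h2 j hj
      simp [hG, feedbackFrom, this]
    have g1 : Set.EqOn G (fun _ => F [(i, Reaction.abandon)]) (E₁ \ E₂) := by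
      rintro ω ⟨⟨h1, h2, h3⟩, h4⟩
      have h5 : X.click t ω i = false := h2 i (Finset.mem_insert_self _ _)
      have h6 : X.patience t ω ≤ ((k + 1 : ℕ) : ℕ∞) := by
        by_contra hcon
        exact h4 ⟨h1, h2, not_le.1 hcon⟩
      simp only [hG, feedbackFrom]
      rw [if_neg (by simp [h5]), if_pos h6]
    have g2 : Set.EqOn G (fun ω => F ((i, Reaction.continue)
        :: feedbackFrom (X.click t ω) (X.patience t ω) (k + 1 + 1) l)) E₂ := by
      rintro ω ⟨h1, h2, h3⟩
      have h5 : X.click t ω i = false := h2 i (Finset.mem_insert_self _ _)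
      simp only [hG, feedbackFrom]
      rw [if_neg (by simp [h5]), if_neg (not_le.2 h3)]
    have i0 : IntegrableOn G (E \ E₁) μ :=
      (integrableOn_congr_fun g0 (hEm.diff hE₁m)).2 (integrableOn_const (measure_ne_top _ _))
    have i1 : IntegrableOn G (E₁ \ E₂) μ :=
      (integrableOn_congr_fun g1 (hE₁m.diff hE₂m)).2 (integrableOn_const (measure_ne_top _ _))
    have i2' : IntegrableOn G E₂ μ := (integrableOn_congr_fun g2 hE₂m).2 i2
    have i3 : IntegrableOn G E₁ μ := by
      rw [← Set.sdiff_union_of_subset h21]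
      exact i1.union i2'
    have i4 : IntegrableOn G E μ := by
      rw [← Set.sdiff_union_of_subset h1E]
      exact i0.union i3
    refine ⟨i4, ?_⟩
    have s0 := setIntegral_sdiff hE₁m i4 h1E
    have s1 := setIntegral_sdiff hE₂m i3 h21
    rw [setIntegral_congr_fun (hEm.diff hE₁m) g0, setIntegral_const,
      measureReal_sdiff h1E hE₁m, m0, m1, smul_eq_mul] at s0
    rw [setIntegral_congr_fun (hE₁m.diff hE₂m) g1, setIntegral_const,
      measureReal_sdiff h21 hE₂m, m1, m2, setIntegral_congr_fun hE₂m g2, j2, smul_eq_mul] at s1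
    simp only [expFeedback]
    linear_combination -s0 - s1

lemma setIntegral_feedback [IsProbabilityMeasure μ] (hu : ∀ i, u i ∈ Set.Icc (0 : ℝ) 1)
    (hq : 0 ≤ q) (t : ℕ) {A : Set Ω} (hA : MeasurableSet[X.present t] A) {S : List (Fin N)}
    (hS : S.Nodup) (F : List (Fin N × Reaction) → ℝ) :
    IntegrableOn (fun ω => F (feedback (X.click t ω) (X.patience t ω) S)) A μ ∧
      ∫ ω in A, F (feedback (X.click t ω) (X.patience t ω) S) ∂μ
        = μ.real A * expFeedback u q S F := by
  have h := X.setIntegral_feedbackFrom hu hq t hA hS ∅ (by simp) 0 F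
  have hm := X.measureReal_unselected hu hq t hA ∅ 0
  have hsub : A ∩ {ω | (∀ j ∈ (∅ : Finset (Fin N)), X.click t ω j = false)
      ∧ ((0 : ℕ) : ℕ∞) < X.patience t ω} ⊆ A := Set.inter_subset_left
  have hpat : Measurable (X.patience t) := (X.measurable_patience t).mono (X.past_le _) le_rfl
  -- The recursion presupposes positive patience; `q ^ 0 = 1` makes the complement a null set.
  have hae : (A ∩ {ω | (∀ j ∈ (∅ : Finset (Fin N)), X.click t ω j = false)
      ∧ ((0 : ℕ) : ℕ∞) < X.patience t ω} : Set Ω) =ᵐ[μ] (A : Set Ω) := by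
    refine ae_eq_of_subset_of_measure_ge hsub ?_ ?_ (measure_ne_top _ _)
    · rw [← ENNReal.toReal_le_toReal (measure_ne_top _ _) (measure_ne_top _ _)]
      simp only [Finset.prod_empty, mul_one, pow_zero] at hm
      exact hm.ge
    · refine ((X.present_le t _ hA).inter ?_).nullMeasurableSet
      have : {ω | (∀ j ∈ (∅ : Finset (Fin N)), X.click t ω j = false)
          ∧ ((0 : ℕ) : ℕ∞) < X.patience t ω} = X.patience t ⁻¹' Set.Ioi ((0 : ℕ) : ℕ∞) := by
        ext ω; simp
      rw [this]
      exact hpat (Set.to_countable _).measurableSet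
  rw [setIntegral_congr_set hae] at h
  rw [integrableOn_congr_set_ae hae] at h
  simpa [feedback] using h

lemma integral_feedback [IsProbabilityMeasure μ] (hu : ∀ i, u i ∈ Set.Icc (0 : ℝ) 1)
    (hq : 0 ≤ q) (t : ℕ) (f : Counts N → ℝ) :
    ∫ ω, f (X.state (t + 1) ω) ∂μ
      = ∫ ω, expFeedback u q (X.seq t ω) (fun m => f ((X.state t ω).updateAll m)) ∂μ := by
  have hm (p : Counts N × List (Fin N)) := X.measurableSet_state_seq t p
  have hnd (p : Counts N × List (Fin N)) (hp : p.2.Nodup) :=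
    X.setIntegral_feedback hu hq t (hm p) hp (fun m => f (p.1.updateAll m))
  have h1 := integral_comp_finite_range (μ := μ) (X.finite_range_state_seq t)
    (fun p => X.present_le t _ (hm p))
    (f := fun p ω => f (p.1.updateAll (feedback (X.click t ω) (X.patience t ω) p.2))) fun p => by
      by_cases hp : p.2.Nodup
      · exact (hnd p hp).1
      · have : {ω | (X.state t ω, X.seq t ω) = p} = ∅ := by
          ext ω
          simp only [Set.mem_ofPred_eq, Set.mem_empty_iff_false, iff_false]
          exact fun h => hp (h ▸ X.nodup_seq t ω)
        rw [this]
        exact integrableOn_empty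
  have h2 := integral_comp_finite_range (μ := μ) (X.finite_range_state_seq t)
    (fun p => X.present_le t _ (hm p))
    (f := fun p _ => expFeedback u q p.2 (fun m => f (p.1.updateAll m))) fun p =>
      integrableOn_const (measure_ne_top _ _)
  simp only [state_succ]
  rw [h1.2, h2.2]
  refine Finset.sum_congr rfl fun p hp => ?_
  have hp' : p.2.Nodup := by
    obtain ⟨ω, rfl⟩ := (Set.Finite.mem_toFinset _).1 hp
    exact X.nodup_seq t ω
  rw [(hnd p hp').2, setIntegral_const, smul_eq_mul]

end Run

/-! ### The sampled payoffs -/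

section sampled

variable {R : ℕ} (α β : ℝ) (r : Fin N → ℝ) (c : ℝ)

/-- The payoff of `S` for the parameters sampled with `θ`. -/
def sampledUtility (s : Counts N) (S : List (Fin N)) (θ : Fin R → ℝ) : ℝ :=
  utility r c (fun i => toUnit (sampleU α β θ s i)) (toUnit (sampleQ α β θ s)) S

/-- The optimal payoff for the parameters sampled with `θ`. -/
def sampledValue (s : Counts N) (θ : Fin R → ℝ) : ℝ :=
  (Finset.univ : Finset {S : List (Fin N) // S.Nodup}).sup' ⟨⟨[], List.nodup_nil⟩, by simp⟩
    fun S => sampledUtility α β r c s S.1 θ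

/-- The mean of the optimal payoff for the sampled parameters. -/
def meanSampledValue (R : ℕ) (s : Counts N) : ℝ :=
  ∫ θ : Fin R → ℝ, sampledValue α β r c s θ ∂(sampleLaw R)

lemma measurable_toUnit_maxSample (a b : ℕ) :
    Measurable fun θ : Fin R → ℝ => toUnit (maxSample α β θ a b) := by
  have : Measurable fun θ : Fin R → ℝ => maxSample α β θ a b := by
    unfold maxSample
    exact Measurable.iSup fun j => by fun_prop
  unfold toUnit
  fun_prop

lemma measurable_sampledUtility (s : Counts N) (S : List (Fin N)) :
    Measurable fun θ : Fin R → ℝ => sampledUtility α β r c s S θ := by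
  unfold sampledUtility
  induction S with
  | nil => simp
  | cons i l ih =>
    simp only [utility_cons]
    have h1 : Measurable fun θ : Fin R → ℝ => toUnit (sampleU α β θ s i) :=
      measurable_toUnit_maxSample α β _ _
    have h2 : Measurable fun θ : Fin R → ℝ => toUnit (sampleQ α β θ s) :=
      measurable_toUnit_maxSample α β _ _
    fun_prop

lemma measurable_sampledValue (s : Counts N) :
    Measurable fun θ : Fin R → ℝ => sampledValue α β r c s θ := by
  have := Finset.measurable_sup' (s := (Finset.univ : Finset {S : List (Fin N) // S.Nodup}))
    ⟨⟨[], List.nodup_nil⟩, by simp⟩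
    (f := fun S (θ : Fin R → ℝ) => sampledUtility α β r c s S.1 θ)
    fun S _ => measurable_sampledUtility α β r c s S.1
  convert this using 2 with θ
  exact (Finset.sup'_apply _ _ _).symm

variable {α β r c}

lemma sampledUtility_le_sampledValue (s : Counts N) {S : List (Fin N)} (hS : S.Nodup)
    (θ : Fin R → ℝ) : sampledUtility α β r c s S θ ≤ sampledValue α β r c s θ :=
  Finset.le_sup' (fun S : {S : List (Fin N) // S.Nodup} => sampledUtility α β r c s S.1 θ)
    (Finset.mem_univ ⟨S, hS⟩)

lemma sampledValue_eq {s : Counts N} {S : List (Fin N)} {θ : Fin R → ℝ}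
    (hS : IsOptimal r c (fun i => toUnit (sampleU α β θ s i)) (toUnit (sampleQ α β θ s)) S) :
    sampledValue α β r c s θ = sampledUtility α β r c s S θ :=
  le_antisymm (Finset.sup'_le _ _ fun S' _ => hS.2 S'.1 S'.2)
    (sampledUtility_le_sampledValue s hS.1 θ)

lemma exists_isOptimal (r : Fin N → ℝ) (c : ℝ) (u : Fin N → ℝ) (q : ℝ) :
    ∃ S, IsOptimal r c u q S := by
  have : Nonempty {S : List (Fin N) // S.Nodup} := ⟨⟨[], List.nodup_nil⟩⟩
  obtain ⟨S, hS⟩ := Finite.exists_max fun S : {S : List (Fin N) // S.Nodup} => utility r c u q S.1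
  exact ⟨S.1, S.2, fun S' h => hS ⟨S', h⟩⟩

lemma abs_sampledUtility_le (hr : ∀ i, r i ∈ Set.Icc (0 : ℝ) 1) (hc : c ∈ Set.Icc (0 : ℝ) 1)
    (s : Counts N) (S : List (Fin N)) (θ : Fin R → ℝ) :
    |sampledUtility α β r c s S θ| ≤ 1 := by
  obtain ⟨h1, h2⟩ := utility_mem_Icc hr hc (fun i => toUnit_mem_Icc (sampleU α β θ s i))
    (toUnit_mem_Icc (sampleQ α β θ s)) S
  unfold sampledUtility
  exact abs_le.2 ⟨by linarith [hc.2], h2⟩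

lemma abs_sampledValue_le (hr : ∀ i, r i ∈ Set.Icc (0 : ℝ) 1) (hc : c ∈ Set.Icc (0 : ℝ) 1)
    (s : Counts N) (θ : Fin R → ℝ) : |sampledValue α β r c s θ| ≤ 1 := by
  obtain ⟨S, hS⟩ := exists_isOptimal r c (fun i => toUnit (sampleU α β θ s i))
    (toUnit (sampleQ α β θ s))
  rw [sampledValue_eq hS]
  exact abs_sampledUtility_le hr hc s S θ

lemma integrable_sampledValue (hr : ∀ i, r i ∈ Set.Icc (0 : ℝ) 1)
    (hc : c ∈ Set.Icc (0 : ℝ) 1) (s : Counts N) :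
    Integrable (fun θ : Fin R → ℝ => sampledValue α β r c s θ) (sampleLaw R) :=
  Integrable.of_bound (measurable_sampledValue α β r c s).aestronglyMeasurable 1
    (Filter.Eventually.of_forall fun θ => abs_sampledValue_le hr hc s θ)

/-! ### Optimism, and reduction of the regret to confidence widths. -/

variable {u : Fin N → ℝ} {q : ℝ}

/-- Bound on the inverse of the probability of an optimistic sample. -/
def optimismFactor (u : Fin N → ℝ) (q : ℝ) (s : Counts N) : ℝ :=
  √(2 * Real.pi) * Real.exp 2 * Real.exp (maxDev u q s ^ 2 / 3)

lemma optimismFactor_pos (u : Fin N → ℝ) (q : ℝ) (s : Counts N) : 0 < optimismFactor u q s := by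
  unfold optimismFactor; positivity

/-- On the optimistic event `O` the sampled value is at least `V`, so the integral of the positive
part is at least `V - m` times the probability of `O`. -/
lemma utility_sub_meanSampledValue_le [NeZero R] (hβ : 2 ≤ β)
    (hr : ∀ i, r i ∈ Set.Icc (0 : ℝ) 1) (hu : ∀ i, u i ∈ Set.Icc (0 : ℝ) 1)
    (hc : c ∈ Set.Icc (0 : ℝ) 1) (hq : q ∈ Set.Icc (0 : ℝ) 1) {s : Counts N}
    (hv : ∀ i, 0 < s.views i) (hs : 0 < s.stays) {S : List (Fin N)} (hS : S.Nodup) :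
    utility r c u q S - meanSampledValue α β r c R s
      ≤ optimismFactor u q s * ∫ θ : Fin R → ℝ,
        max (sampledValue α β r c s θ - meanSampledValue α β r c R s) 0 ∂(sampleLaw R) := by
  set m := meanSampledValue α β r c R s
  set V := utility r c u q S
  set D := maxDev u q s with hD
  have hD0 : 0 ≤ D := maxDev_nonneg u q s
  have hβ0 : 0 < β := by linarith
  have hint : Integrable (fun θ : Fin R → ℝ => sampledValue α β r c s θ - m) (sampleLaw R) :=
    (integrable_sampledValue hr hc s).sub (integrable_const _)
  have hint' : Integrable (fun θ : Fin R → ℝ => max (sampledValue α β r c s θ - m) 0)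
      (sampleLaw R) := hint.pos_part
  set I := ∫ θ : Fin R → ℝ, max (sampledValue α β r c s θ - m) 0 ∂(sampleLaw R)
  have hI : 0 ≤ I := integral_nonneg fun θ => le_max_right _ _
  have hP := optimismFactor_pos u q s
  rcases le_or_gt (V - m) 0 with h | h
  · exact h.trans (mul_nonneg hP.le hI)
  set O := {θ : Fin R → ℝ | D / √β ≤ θ 0} with hO
  have hOm : MeasurableSet O := measurableSet_le measurable_const (measurable_pi_apply 0)
  have hOV : ∀ θ ∈ O, V ≤ sampledValue α β r c s θ := by
    intro θ hθ
    obtain ⟨S', hS'⟩ := exists_isOptimal r c (fun i => toUnit (sampleU α β θ s i))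
      (toUnit (sampleQ α β θ s))
    rw [sampledValue_eq hS']
    exact utility_le_of_isOptimal hc.1 hu hq.1 (toUnit_mem_Icc _).2
      (fun i => le_toUnit_maxSample hβ0 (hu i).2 hD0 (hv i) (sqDev_item_le u q s i) hθ)
      (le_toUnit_maxSample hβ0 hq.2 hD0 hs (sqDev_stay_le u q s) hθ) hS hS'
  have h1 : (V - m) * (sampleLaw R).real O ≤ I := by
    calc (V - m) * (sampleLaw R).real O = ∫ θ in O, (V - m) ∂(sampleLaw R) := by
          rw [setIntegral_const, smul_eq_mul, mul_comm]
      _ ≤ ∫ θ in O, max (sampledValue α β r c s θ - m) 0 ∂(sampleLaw R) :=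
          setIntegral_mono_on (integrableOn_const (measure_ne_top _ _)) hint'.integrableOn hOm
            fun θ hθ => le_max_of_le_left (sub_le_sub_right (hOV θ hθ) m)
      _ ≤ I := setIntegral_le_integral hint' (Filter.Eventually.of_forall fun θ => le_max_right _ _)
  have h2 : (optimismFactor u q s)⁻¹ ≤ (sampleLaw R).real O := by
    refine le_trans ?_ (le_sampleLaw (D / √β) (0 : Fin R))
    unfold optimismFactor
    rw [mul_inv _ (Real.exp (maxDev u q s ^ 2 / 3)), ← Real.exp_neg, div_pow,
      Real.sq_sqrt hβ0.le, ← hD]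
    gcongr
    -- The only use of `β ≥ 2`: the exponent `(2/3) D²/β` becomes at most `D²/3`, whose third power
    -- is still integrable together with a polynomial factor.
    have : D ^ 2 / β ≤ D ^ 2 / 2 := by gcongr
    linarith
  have h3 : (V - m) * (optimismFactor u q s)⁻¹ ≤ I :=
    (mul_le_mul_of_nonneg_left h2 h.le).trans h1
  rw [← div_eq_mul_inv, div_le_iff₀ hP] at h3
  linarith

/-- Width of the confidence intervals, relative to the numbers of observations. -/
def viewWidth (u : Fin N → ℝ) (q : ℝ) (s : Counts N) (S : List (Fin N)) : ℝ :=
  viewSum u q (fun i => 1 / √(s.views i)) (1 / √s.stays) S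

lemma abs_sampledUtility_sub_le [NeZero R] (hα : 0 ≤ α) (hβ : 0 ≤ β)
    (hr : ∀ i, r i ∈ Set.Icc (0 : ℝ) 1) (hu : ∀ i, u i ∈ Set.Icc (0 : ℝ) 1)
    (hc : c ∈ Set.Icc (0 : ℝ) 1) (hq : q ∈ Set.Icc (0 : ℝ) 1) {s : Counts N}
    (hv : ∀ i, 0 < s.views i) (hs : 0 < s.stays) (S : List (Fin N)) (θ : Fin R → ℝ) :
    |sampledUtility α β r c s S θ - utility r c u q S|
      ≤ 2 * (maxDev u q s + (√α + √β) * ‖θ‖) * viewWidth u q s S := by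
  refine (abs_utility_sub_le hr hc hu hq (fun i => toUnit_mem_Icc _) (toUnit_mem_Icc _) S).trans ?_
  rw [mul_assoc, viewWidth, ← viewSum_mul u q (maxDev u q s + (√α + √β) * ‖θ‖)]
  refine mul_le_mul_of_nonneg_left (viewSum_mono hu hq.1 (fun i => ?_) ?_ S) two_pos.le
  · have := abs_toUnit_maxSample_sub_le hα hβ (hu i) (maxDev_nonneg u q s) (hv i)
      (sqDev_item_le u q s i) θ
    simpa [Counts.views, sampleU] using this
  · have := abs_toUnit_maxSample_sub_le hα hβ hq (maxDev_nonneg u q s) hs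
      (sqDev_stay_le u q s) θ
    simpa [Counts.stays, sampleQ] using this

lemma viewWidth_nonneg (hu : ∀ i, u i ∈ Set.Icc (0 : ℝ) 1) (hq : 0 ≤ q) (s : Counts N)
    (S : List (Fin N)) : 0 ≤ viewWidth u q s S :=
  viewSum_nonneg hu hq (fun _ => by positivity) (by positivity) S

/-- The sequence `S` competes under an independent resample `θ'` as well, so the sampled value at
`θ'` is at least the payoff of `S` there. Both payoffs are close to the true payoff of `S`;
averaging over `θ'` replaces `‖θ'‖` by its mean, at most `2 * sampleScale R`. -/
lemma sampledUtility_sub_meanSampledValue_le [NeZero R] (hα : 0 ≤ α) (hβ : 0 ≤ β)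
    (hr : ∀ i, r i ∈ Set.Icc (0 : ℝ) 1) (hu : ∀ i, u i ∈ Set.Icc (0 : ℝ) 1)
    (hc : c ∈ Set.Icc (0 : ℝ) 1) (hq : q ∈ Set.Icc (0 : ℝ) 1) {s : Counts N}
    (hv : ∀ i, 0 < s.views i) (hs : 0 < s.stays) {S : List (Fin N)} (hS : S.Nodup)
    (θ : Fin R → ℝ) :
    sampledUtility α β r c s S θ - meanSampledValue α β r c R s
      ≤ 2 * (2 * maxDev u q s + (√α + √β) * ‖θ‖ + 2 * (√α + √β) * sampleScale R)
        * viewWidth u q s S := by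
  set D := maxDev u q s
  set C := √α + √β with hC
  set w := viewWidth u q s S
  have hw : 0 ≤ w := viewWidth_nonneg hu hq.1 s S
  have hC0 : 0 ≤ C := by positivity
  obtain ⟨n1, n2⟩ := integral_norm_le (R := R)
  set x := sampledUtility α β r c s S θ with hx
  have h1 (θ' : Fin R → ℝ) :
      x - 2 * (2 * D + C * ‖θ‖) * w - 2 * C * w * ‖θ'‖ ≤ sampledValue α β r c s θ' := by
    have a1 := (abs_le.1 (abs_sampledUtility_sub_le hα hβ hr hu hc hq hv hs S θ)).2
    have a2 := (abs_le.1 (abs_sampledUtility_sub_le hα hβ hr hu hc hq hv hs S θ')).1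
    have a3 := sampledUtility_le_sampledValue (α := α) (β := β) (r := r) (c := c) s hS θ'
    linarith
  have h2 := integral_mono (((integrable_const (μ := sampleLaw R)
    (x - 2 * (2 * D + C * ‖θ‖) * w)).sub (n1.const_mul (2 * C * w))))
    (integrable_sampledValue hr hc s) h1
  simp only [Pi.sub_apply] at h2
  rw [integral_sub (integrable_const _) (n1.const_mul _), integral_const, integral_const_mul,
    probReal_univ, one_smul] at h2
  have h3 : 2 * C * w * ∫ θ : Fin R → ℝ, ‖θ‖ ∂(sampleLaw R)
      ≤ 2 * C * w * (2 * sampleScale R) := mul_le_mul_of_nonneg_left n2 (by positivity)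
  have h4 : meanSampledValue α β r c R s
      = ∫ θ : Fin R → ℝ, sampledValue α β r c s θ ∂(sampleLaw R) := rfl
  rw [h4]
  linarith

/-- Factor between the width of the confidence intervals and the regret of a round. -/
def regretFactor (α β : ℝ) {R : ℕ} (u : Fin N → ℝ) (q : ℝ) (s : Counts N) (θ : Fin R → ℝ) : ℝ :=
  (√(2 * Real.pi) * Real.exp 2 + 1) * Real.exp (maxDev u q s ^ 2 / 3)
    * (4 * maxDev u q s + 2 * (√α + √β) * ‖θ‖ + 4 * (√α + √β) * sampleScale R)

lemma regretFactor_nonneg (α β : ℝ) (u : Fin N → ℝ) (q : ℝ) (s : Counts N) (θ : Fin R → ℝ) :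
    0 ≤ regretFactor α β u q s θ := by
  have := maxDev_nonneg u q s
  have : 0 ≤ sampleScale R := Real.sqrt_nonneg _
  unfold regretFactor
  positivity

/-- Since `S` is optimal for the samples, both terms are widths of this same `S`, the optimal true
sequence having disappeared. Only views of the offered items have to be paid for. -/
lemma optimismFactor_mul_add_le [NeZero R] (hα : 0 ≤ α) (hβ : 0 ≤ β)
    (hr : ∀ i, r i ∈ Set.Icc (0 : ℝ) 1) (hu : ∀ i, u i ∈ Set.Icc (0 : ℝ) 1)
    (hc : c ∈ Set.Icc (0 : ℝ) 1) (hq : q ∈ Set.Icc (0 : ℝ) 1) {s : Counts N}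
    (hv : ∀ i, 0 < s.views i) (hs : 0 < s.stays) {S : List (Fin N)} {θ : Fin R → ℝ}
    (hS : IsOptimal r c (fun i => toUnit (sampleU α β θ s i)) (toUnit (sampleQ α β θ s)) S) :
    optimismFactor u q s * max (sampledValue α β r c s θ - meanSampledValue α β r c R s) 0
        + (sampledValue α β r c s θ - utility r c u q S)
      ≤ regretFactor α β u q s θ * viewWidth u q s S := by
  rw [sampledValue_eq hS]
  set D := maxDev u q s with hD
  set w := viewWidth u q s S
  have hw : 0 ≤ w := viewWidth_nonneg hu hq.1 s S
  have hD0 : 0 ≤ D := maxDev_nonneg u q s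
  have hL : 0 ≤ sampleScale R := Real.sqrt_nonneg _
  have hC0 : 0 ≤ √α + √β := by positivity
  set y := 2 * (2 * D + (√α + √β) * ‖θ‖ + 2 * (√α + √β) * sampleScale R) with hy
  have hy0 : 0 ≤ y := by positivity
  have h1 : max (sampledUtility α β r c s S θ - meanSampledValue α β r c R s) 0 ≤ y * w :=
    max_le (sampledUtility_sub_meanSampledValue_le hα hβ hr hu hc hq hv hs hS.1 θ)
      (mul_nonneg hy0 hw)
  have h2 : sampledUtility α β r c s S θ - utility r c u q S ≤ y * w := by
    refine ((le_abs_self _).trans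
      (abs_sampledUtility_sub_le hα hβ hr hu hc hq hv hs S θ)).trans ?_
    refine mul_le_mul_of_nonneg_right ?_ hw
    have : 0 ≤ (√α + √β) * sampleScale R := by positivity
    rw [hy]
    linarith
  have h3 : optimismFactor u q s + 1
      ≤ (√(2 * Real.pi) * Real.exp 2 + 1) * Real.exp (D ^ 2 / 3) := by
    have : 1 ≤ Real.exp (D ^ 2 / 3) := Real.one_le_exp (by positivity)
    unfold optimismFactor
    rw [← hD]
    linarith
  calc _ ≤ optimismFactor u q s * (y * w) + y * w :=
        add_le_add (mul_le_mul_of_nonneg_left h1 (optimismFactor_pos u q s).le) h2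
    _ = (optimismFactor u q s + 1) * (y * w) := by ring
    _ ≤ _ := mul_le_mul_of_nonneg_right h3 (mul_nonneg hy0 hw)
    _ = _ := by rw [regretFactor, ← hD]; ring

lemma add_pow_three_le {a b c : ℝ} (ha : 0 ≤ a) (hb : 0 ≤ b) (hc : 0 ≤ c) :
    (a + b + c) ^ 3 ≤ 9 * (a ^ 3 + b ^ 3 + c ^ 3) := by
  nlinarith [mul_nonneg (add_nonneg ha hb) (sq_nonneg (a - b)),
    mul_nonneg (add_nonneg ha hc) (sq_nonneg (a - c)),
    mul_nonneg (add_nonneg hb hc) (sq_nonneg (b - c)),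
    mul_nonneg ha (sq_nonneg (b - c)), mul_nonneg hb (sq_nonneg (a - c)),
    mul_nonneg hc (sq_nonneg (a - b))]

/-- Constant in the bound on the third moment of `regretFactor`. -/
def momentConst (α β : ℝ) : ℝ :=
  (√(2 * Real.pi) * Real.exp 2 + 1) ^ 3 * (9 * (256 + 288 * (√α + √β) ^ 3))

lemma momentConst_pos (α β : ℝ) : 0 < momentConst α β := by
  unfold momentConst; positivity

/-- The cube turns `exp(D²/3)` into `exp(D²)`, and `D³` is absorbed by `exp(D²/2)`. The product is
`exp(3D²/2)`, which is `devWeight`. -/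
lemma integral_regretFactor_pow_three_le [NeZero R] (α β : ℝ) (u : Fin N → ℝ) (q : ℝ)
    (s : Counts N) :
    Integrable (fun θ : Fin R → ℝ => regretFactor α β u q s θ ^ 3) (sampleLaw R) ∧
      ∫ θ : Fin R → ℝ, regretFactor α β u q s θ ^ 3 ∂(sampleLaw R)
        ≤ momentConst α β * sampleScale R ^ 3 * devWeight u q s := by
  set D := maxDev u q s with hD
  set L := sampleScale R with hL
  set C := √α + √β with hC
  set P := √(2 * Real.pi) * Real.exp 2 + 1 with hP
  have hD0 : 0 ≤ D := maxDev_nonneg u q s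
  have hL1 : 1 ≤ L := one_le_sampleScale NeZero.one_le
  have hL3 : 1 ≤ L ^ 3 := one_le_pow₀ hL1
  have hC0 : 0 ≤ C := by positivity
  have hP0 : 0 ≤ P := by positivity
  obtain ⟨n1, n2⟩ := integral_norm_pow_three_le (R := R)
  have hle (θ : Fin R → ℝ) : regretFactor α β u q s θ ^ 3
      ≤ P ^ 3 * Real.exp (D ^ 2) * (9 * (64 * D ^ 3 + 64 * C ^ 3 * L ^ 3))
        + P ^ 3 * Real.exp (D ^ 2) * (72 * C ^ 3) * ‖θ‖ ^ 3 := by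
    have e : Real.exp (D ^ 2 / 3) ^ 3 = Real.exp (D ^ 2) := by
      rw [← Real.exp_nat_mul]; congr 1; push_cast; ring
    have h1 := add_pow_three_le (a := 4 * D) (b := 2 * C * ‖θ‖) (c := 4 * C * L)
      (by positivity) (by positivity) (by positivity)
    unfold regretFactor
    rw [mul_pow, mul_pow, e]
    calc _ ≤ P ^ 3 * Real.exp (D ^ 2)
          * (9 * ((4 * D) ^ 3 + (2 * C * ‖θ‖) ^ 3 + (4 * C * L) ^ 3)) :=
          mul_le_mul_of_nonneg_left h1 (by positivity)
      _ = _ := by ring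
  have hb := (integrable_const (μ := sampleLaw R)
    (P ^ 3 * Real.exp (D ^ 2) * (9 * (64 * D ^ 3 + 64 * C ^ 3 * L ^ 3)))).add
    (n1.const_mul (P ^ 3 * Real.exp (D ^ 2) * (72 * C ^ 3)))
  have hint : Integrable (fun θ : Fin R → ℝ => regretFactor α β u q s θ ^ 3) (sampleLaw R) := by
    refine hb.mono' ?_ (Filter.Eventually.of_forall fun θ => ?_)
    · unfold regretFactor
      exact Measurable.aestronglyMeasurable (by fun_prop)
    · rw [Real.norm_eq_abs, abs_of_nonneg (pow_nonneg (regretFactor_nonneg α β u q s θ) 3)]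
      exact hle θ
  refine ⟨hint, (integral_mono hint hb hle).trans ?_⟩
  simp only [Pi.add_apply]
  rw [integral_add (integrable_const _) (n1.const_mul _), integral_const, integral_const_mul,
    probReal_univ, one_smul]
  have h1 : D ^ 3 ≤ 4 * Real.exp (D ^ 2 / 2) := by
    have := Real.quadratic_le_exp_of_nonneg (x := D ^ 2 / 2) (by positivity)
    nlinarith [sq_nonneg (D - 1), mul_nonneg hD0 (sq_nonneg (D - 1)), sq_nonneg (D ^ 2 - D)]
  have h2 : Real.exp (D ^ 2) * Real.exp (D ^ 2 / 2) = devWeight u q s := by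
    rw [← exp_maxDev_sq, ← Real.exp_add]; congr 1; ring
  have h3 : 1 ≤ Real.exp (D ^ 2 / 2) := Real.one_le_exp (by positivity)
  calc _ ≤ P ^ 3 * Real.exp (D ^ 2) * (9 * (64 * D ^ 3 + 64 * C ^ 3 * L ^ 3))
        + P ^ 3 * Real.exp (D ^ 2) * (72 * C ^ 3) * (28 * L ^ 3) := by gcongr
    _ = P ^ 3 * Real.exp (D ^ 2) * (9 * (64 * D ^ 3 + 288 * C ^ 3 * L ^ 3)) := by ring
    _ ≤ P ^ 3 * Real.exp (D ^ 2) * (9 * (256 * (L ^ 3 * Real.exp (D ^ 2 / 2))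
          + 288 * C ^ 3 * (L ^ 3 * Real.exp (D ^ 2 / 2)))) := by
        have h4 : Real.exp (D ^ 2 / 2) ≤ L ^ 3 * Real.exp (D ^ 2 / 2) :=
          le_mul_of_one_le_left (Real.exp_pos _).le hL3
        have h5 : L ^ 3 ≤ L ^ 3 * Real.exp (D ^ 2 / 2) :=
          le_mul_of_one_le_right (by positivity) h3
        have h6 : 288 * C ^ 3 * L ^ 3 ≤ 288 * C ^ 3 * (L ^ 3 * Real.exp (D ^ 2 / 2)) :=
          mul_le_mul_of_nonneg_left h5 (by positivity)
        refine mul_le_mul_of_nonneg_left ?_ (by positivity)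
        linarith
    _ = momentConst α β * L ^ 3 * (Real.exp (D ^ 2) * Real.exp (D ^ 2 / 2)) := by
        rw [momentConst]; ring
    _ = _ := by rw [h2]

end sampled

namespace Run

variable {α β : ℝ} {R : ℕ} {r : Fin N → ℝ} {c : ℝ} {u : Fin N → ℝ} {q : ℝ}
  {Ω : Type*} [mΩ : MeasurableSpace Ω] {μ : Measure Ω}
  (X : Run α β R r c u q μ)

/-! ### Pathwise bounds -/

/-- Cost of the views of a round in terms of `potential`. -/
def viewCost (u : Fin N → ℝ) (q : ℝ) (s : Counts N) (S : List (Fin N)) : ℝ :=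
  viewSum u q (fun i => 1 / (8 * root4 (s.views i) ^ 3)) (1 / (8 * root4 s.stays ^ 3)) S

/-- The abandonment counter is of order `N T`; with its weight this gives `N^(3/4) (N T)^(1/4) = N
T^(1/4)`, the same order as the sum over the items. -/
lemma potential_state_le (hN : 1 ≤ N) {T : ℕ} (hT : 2 ≤ T) (ω : Ω) :
    potential (X.state T ω) ≤ 4 * N * root4 T := by
  have hN' : (1 : ℝ) ≤ N := by exact_mod_cast hN
  have hT' : (2 : ℝ) ≤ T := by exact_mod_cast hT
  have h2 := root4_two_le
  have hT0 := root4_nonneg T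
  have hN0 := root4_nonneg N
  have h1 (i : Fin N) : root4 ((X.state T ω).views i) ≤ 2 * root4 T := by
    calc root4 ((X.state T ω).views i) ≤ root4 (2 * T) := by
          refine root4_mono ?_
          have : ((X.state T ω).views i : ℝ) ≤ T + 2 := by exact_mod_cast X.views_state_le T ω i
          linarith
      _ = root4 2 * root4 T := root4_mul (by norm_num) _
      _ ≤ _ := by gcongr
  have h3 : root4 (X.state T ω).stays ≤ 2 * (root4 N * root4 T) := by
    calc root4 (X.state T ω).stays ≤ root4 (2 * (N * T)) := by
          refine root4_mono ?_
          have : ((X.state T ω).stays : ℝ) ≤ N * T + 2 := by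
            exact_mod_cast X.stays_state_le T ω
          nlinarith
      _ = root4 2 * (root4 N * root4 T) := by
          rw [root4_mul (by norm_num), root4_mul (by positivity)]
      _ ≤ _ := by gcongr
  have h4 := Finset.sum_le_card_nsmul Finset.univ _ _ fun i (_ : i ∈ Finset.univ) => h1 i
  rw [Finset.card_univ, Fintype.card_fin, nsmul_eq_mul] at h4
  have h5 : root4 N ^ 3 * root4 (X.state T ω).stays ≤ 2 * N * root4 T := by
    calc _ ≤ root4 N ^ 3 * (2 * (root4 N * root4 T)) := by gcongr
      _ = 2 * root4 N ^ 4 * root4 T := by ring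
      _ = _ := by rw [root4_pow_four (by positivity)]
  unfold potential
  linarith

/-- Young's inequality is applied for each view with `v = n^(1/4)`. At most `N` items are viewed,
each with at most two contributions, hence the factor `2 * N`. -/
lemma regretFactor_mul_viewWidth_le (hu : ∀ i, u i ∈ Set.Icc (0 : ℝ) 1)
    (hq : q ∈ Set.Icc (0 : ℝ) 1) {δ : ℝ} (hδ : 0 < δ) (t : ℕ) (ω : Ω) :
    regretFactor α β u q (X.state t ω) (X.θ t ω) * viewWidth u q (X.state t ω) (X.seq t ω)
      ≤ δ ^ 2 * (2 * N) * regretFactor α β u q (X.state t ω) (X.θ t ω) ^ 3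
        + 8 * δ⁻¹ * viewCost u q (X.state t ω) (X.seq t ω) := by
  set s := X.state t ω with hs
  set y := regretFactor α β u q s (X.θ t ω)
  have hy : 0 ≤ y := regretFactor_nonneg α β u q s _
  have hyoung {n : ℕ} (hn : 2 ≤ n) :
      y * (1 / √n) ≤ δ ^ 2 * y ^ 3 * 1 + 8 * δ⁻¹ * (1 / (8 * root4 n ^ 3)) := by
    have hn' : (0 : ℝ) < n := by exact_mod_cast two_pos.trans_le hn
    have := div_sq_le_young hy hδ (root4_pos hn')
    rw [root4_sq] at this
    refine this.trans_eq ?_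
    have := root4_pos hn'
    field_simp
  unfold viewWidth viewCost
  rw [← viewSum_mul]
  refine (viewSum_mono hu hq.1 (fun i => hyoung (X.two_le_views_state t ω i))
    (hyoung (X.two_le_stays_state t ω)) _).trans ?_
  rw [viewSum_add, viewSum_mul, viewSum_mul]
  have hlen : ((X.seq t ω).length : ℝ) ≤ N := by
    have : (X.seq t ω).length ≤ N := by simpa using (X.nodup_seq t ω).length_le_card
    exact_mod_cast this
  have h1 : viewSum u q (fun _ => 1) 1 (X.seq t ω) ≤ 2 * N :=
    (viewSum_const_one_le hu hq _).trans (by linarith)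
  have h2 := mul_le_mul_of_nonneg_left h1 (by positivity : 0 ≤ δ ^ 2 * y ^ 3)
  rw [← hs]
  linarith

variable [IsProbabilityMeasure μ]

/-! ### The expected deviations -/

lemma integral_state_le_init (hu : ∀ i, u i ∈ Set.Icc (0 : ℝ) 1) (hq : 0 ≤ q)
    {f : Counts N → ℝ}
    (hf : ∀ S s, expFeedback u q S (fun m => f (s.updateAll m)) ≤ f s) (t : ℕ) :
    ∫ ω, f (X.state t ω) ∂μ ≤ f (Counts.init N) := by
  induction t with
  | zero =>
    have : ∀ ω, f (X.state 0 ω) = f (Counts.init N) := fun _ => rfl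
    simp [this]
  | succ t ih =>
    rw [X.integral_feedback hu hq t f]
    refine le_trans (integral_mono ?_ (X.integrable_state t f) fun ω => hf _ _) ih
    exact X.integrable_state_seq t fun s S => expFeedback u q S fun m => f (s.updateAll m)

lemma integral_exp_sqDev_le (t : ℕ) {p : ℝ} (hp : p ∈ Set.Icc (0 : ℝ) 1) {K : ℕ}
    {a b : Counts N → ℕ}
    (hw : ∀ x : ℝ, |x| ≤ 2 →
      ∫ ω, expWeight p x (a (X.state t ω)) (b (X.state t ω)) ∂μ ≤ Real.exp 2)
    (h0 : ∀ ω, 0 < a (X.state t ω) + b (X.state t ω))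
    (hK : ∀ ω, a (X.state t ω) + b (X.state t ω) ≤ 4 ^ K) :
    ∫ ω, Real.exp (3 / 2 * sqDev p (a (X.state t ω)) (b (X.state t ω))) ∂μ
      ≤ Real.exp (3 / 2) + K * (2 * Real.exp 2) := by
  have hi (x : ℝ) : Integrable (fun ω => expWeight p x (a (X.state t ω)) (b (X.state t ω))) μ :=
    X.integrable_state t fun s => expWeight p x (a s) (b s)
  have hsum : Integrable (fun ω => ∑ k ∈ Finset.range K,
      (expWeight p (2 / 2 ^ k) (a (X.state t ω)) (b (X.state t ω))
        + expWeight p (-(2 / 2 ^ k)) (a (X.state t ω)) (b (X.state t ω)))) μ :=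
    integrable_finsetSum _ fun k _ => (hi _).add (hi _)
  refine (integral_mono (X.integrable_state t fun s => Real.exp (3 / 2 * sqDev p (a s) (b s)))
    ((integrable_const (Real.exp (3 / 2))).add hsum)
    fun ω => exp_sqDev_le hp (h0 ω) (hK ω)).trans ?_
  simp only [Pi.add_apply]
  rw [integral_add (integrable_const _) hsum, integral_const, probReal_univ, one_smul]
  gcongr
  have e := integral_finsetSum (μ := μ) (Finset.range K) (f := fun k ω =>
      expWeight p (2 / 2 ^ k) (a (X.state t ω)) (b (X.state t ω))
        + expWeight p (-(2 / 2 ^ k)) (a (X.state t ω)) (b (X.state t ω)))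
      fun k _ => (hi _).add (hi _)
  rw [e]
  refine (Finset.sum_le_card_nsmul _ _ (2 * Real.exp 2) fun k _ => ?_).trans_eq (by simp)
  rw [integral_add (hi _) (hi _)]
  have h1 : |(2 : ℝ) / 2 ^ k| ≤ 2 := by
    rw [abs_of_nonneg (by positivity)]
    exact div_le_self (by norm_num) (one_le_pow₀ (by norm_num))
  linarith [hw _ h1, hw (-(2 / 2 ^ k)) (by rwa [abs_neg])]

lemma integral_devWeight_le (hu : ∀ i, u i ∈ Set.Icc (0 : ℝ) 1) (hq : q ∈ Set.Icc (0 : ℝ) 1)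
    (hN : 1 ≤ N) (t : ℕ) {K : ℕ} (hK : N * t + 2 ≤ 4 ^ K) :
    ∫ ω, devWeight u q (X.state t ω) ∂μ
      ≤ (N + 1) * (Real.exp (3 / 2) + K * (2 * Real.exp 2)) := by
  have h1 (i : Fin N) := X.integral_exp_sqDev_le t (hu i) (K := K) (a := fun s => s.sel i)
    (b := fun s => s.unsel i) (fun x hx => (X.integral_state_le_init hu hq.1
      (f := fun s => expWeight (u i) x (s.sel i) (s.unsel i))
      (fun S s => expFeedback_expWeight_item_le hu hq i x S s) t).trans
        (expWeight_one_le (hu i) hx))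
    (fun ω => two_pos.trans_le (X.two_le_views_state t ω i))
    (fun ω => (X.views_state_le t ω i).trans (le_trans (by nlinarith) hK))
  have h2 := X.integral_exp_sqDev_le t hq (K := K) (a := fun s => s.cont)
    (b := fun s => s.aband) (fun x hx => (X.integral_state_le_init hu hq.1
      (f := fun s => expWeight q x s.cont s.aband)
      (fun S s => expFeedback_expWeight_stay_le hu hq x S s) t).trans
        (expWeight_one_le hq hx))
    (fun ω => two_pos.trans_le (X.two_le_stays_state t ω))
    (fun ω => (X.stays_state_le t ω).trans hK)
  have i1 (i : Fin N) := X.integrable_state t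
    fun s => Real.exp (3 / 2 * sqDev (u i) (s.sel i) (s.unsel i))
  have i2 := X.integrable_state t fun s => Real.exp (3 / 2 * sqDev q s.cont s.aband)
  unfold devWeight
  rw [integral_add (integrable_finsetSum _ fun i _ => i1 i) i2,
    integral_finsetSum _ fun i _ => i1 i]
  have h3 := Finset.sum_le_card_nsmul Finset.univ _ _ fun i (_ : i ∈ Finset.univ) => h1 i
  rw [Finset.card_univ, Fintype.card_fin, nsmul_eq_mul] at h3
  linarith

/-! ### The expected widths -/

/-- The cost of a round is at most the expected increase of the potential, and the increases
telescope. -/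
lemma sum_integral_viewCost_le_potential (hu : ∀ i, u i ∈ Set.Icc (0 : ℝ) 1)
    (hq : q ∈ Set.Icc (0 : ℝ) 1) (T : ℕ) :
    ∑ t ∈ Finset.range T, ∫ ω, viewCost u q (X.state t ω) (X.seq t ω) ∂μ
      ≤ ∫ ω, potential (X.state T ω) ∂μ := by
  have h0 : 0 ≤ ∫ ω, potential (X.state 0 ω) ∂μ := by
    refine integral_nonneg fun ω => ?_
    have h (x : ℝ) := root4_nonneg x
    exact add_nonneg (Finset.sum_nonneg fun i _ => h _) (mul_nonneg (pow_nonneg (h _) 3) (h _))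
  have h1 (t : ℕ) : ∫ ω, viewCost u q (X.state t ω) (X.seq t ω) ∂μ
      ≤ ∫ ω, potential (X.state (t + 1) ω) ∂μ - ∫ ω, potential (X.state t ω) ∂μ := by
    have i1 := X.integrable_state t potential
    have i2 := X.integrable_state_seq t (viewCost u q)
    have h2 := integral_mono (i1.add i2) (X.integrable_state_seq t
      fun s S => expFeedback u q S fun m => potential (s.updateAll m)) fun ω => by
        have hlen : (X.seq t ω).length ≤ N := by simpa using (X.nodup_seq t ω).length_le_card
        exact potential_add_viewSum_le hu hq
          (fun i => le_trans one_le_two (X.two_le_views_state t ω i))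
          (le_trans one_le_two (X.two_le_stays_state t ω)) (X.nodup_seq t ω) (X.state t ω)
          (fun _ _ => rfl) (by omega)
    rw [← X.integral_feedback hu hq.1 t potential] at h2
    simp only [Pi.add_apply] at h2
    rw [integral_add i1 i2] at h2
    linarith
  have h3 := Finset.sum_le_sum fun t (_ : t ∈ Finset.range T) => h1 t
  rw [Finset.sum_range_sub (fun t => ∫ ω, potential (X.state t ω) ∂μ)] at h3
  linarith

lemma sum_integral_viewCost_le (hu : ∀ i, u i ∈ Set.Icc (0 : ℝ) 1)
    (hq : q ∈ Set.Icc (0 : ℝ) 1) (hN : 1 ≤ N) {T : ℕ} (hT : 2 ≤ T) :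
    ∑ t ∈ Finset.range T, ∫ ω, viewCost u q (X.state t ω) (X.seq t ω) ∂μ
      ≤ 4 * N * root4 T := by
  refine (X.sum_integral_viewCost_le_potential hu hq T).trans ?_
  refine (integral_mono (X.integrable_state T potential) (integrable_const _)
    fun ω => X.potential_state_le hN hT ω).trans_eq (by simp)

/-! ### The regret of a round -/

/-- The regret splits as `(V - m) + (m - G) + (G - U(S^t))`. The middle term integrates to zero
because the samples are independent of the past. The factor `P` depends on the counters only, so the
resampled positive part in the bound on `V - m` may be replaced by the one of the actual sample. -/
lemma integral_regret_round_le [NeZero R] (hα : 0 < α) (hβ : 2 ≤ β)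
    (hr : ∀ i, r i ∈ Set.Icc (0 : ℝ) 1) (hu : ∀ i, u i ∈ Set.Icc (0 : ℝ) 1)
    (hc : c ∈ Set.Icc (0 : ℝ) 1) (hq : q ∈ Set.Icc (0 : ℝ) 1) {S : List (Fin N)} (hS : S.Nodup)
    {δ : ℝ} (hδ : 0 < δ) (t : ℕ) :
    ∫ ω, (utility r c u q S - utility r c u q (X.seq t ω)) ∂μ
      ≤ δ ^ 2 * (2 * N) * (momentConst α β * sampleScale R ^ 3
          * ∫ ω, devWeight u q (X.state t ω) ∂μ)
        + 8 * δ⁻¹ * ∫ ω, viewCost u q (X.state t ω) (X.seq t ω) ∂μ := by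
  set V := utility r c u q S
  set m := meanSampledValue α β r c R
  set G : Counts N → (Fin R → ℝ) → ℝ := sampledValue α β r c
  set P := optimismFactor u q
  have hv (t : ℕ) (ω : Ω) (i : Fin N) : 0 < (X.state t ω).views i :=
    two_pos.trans_le (X.two_le_views_state t ω i)
  have hs (t : ℕ) (ω : Ω) : 0 < (X.state t ω).stays :=
    two_pos.trans_le (X.two_le_stays_state t ω)
  have iG (s : Counts N) := integrable_sampledValue (R := R) (α := α) (β := β) hr hc s
  have mG (s : Counts N) := measurable_sampledValue (R := R) α β r c s
  have e1 := X.integral_state_sample t (f := fun s θ => P s * max (G s θ - m s) 0)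
    (fun s => (((mG s).sub_const _).max measurable_const |>.const_mul _).stronglyMeasurable)
    (fun s => (((iG s).sub (integrable_const _)).pos_part).const_mul _)
  have e2 := X.integral_state_sample t (f := fun s θ => m s - G s θ)
    (fun s => ((mG s).const_sub _).stronglyMeasurable)
    (fun s => (integrable_const _).sub (iG s))
  have e3 := X.integral_state_sample t (f := fun s θ => regretFactor α β u q s θ ^ 3)
    (fun s => by
      unfold regretFactor
      exact Measurable.stronglyMeasurable (by fun_prop))
    (fun s => (integral_regretFactor_pow_three_le α β u q s).1)
  have e2' : ∫ ω, (m (X.state t ω) - G (X.state t ω) (X.θ t ω)) ∂μ = 0 := by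
    rw [e2.2]
    have (s : Counts N) : ∫ θ, (m s - G s θ) ∂(sampleLaw R) = 0 := by
      rw [integral_sub (integrable_const _) (iG s), integral_const, probReal_univ, one_smul]
      exact sub_self _
    simp [this]
  have i0 := X.integrable_state t fun s => V - m s
  have i1 : Integrable (fun ω => G (X.state t ω) (X.θ t ω) - utility r c u q (X.seq t ω)) μ := by
    have := ((X.integrable_state t m).sub e2.1).sub
      (X.integrable_state_seq t fun _ S => utility r c u q S)
    refine this.congr (Filter.Eventually.of_forall fun ω => ?_)
    simp
  have h0 : ∫ ω, (V - m (X.state t ω)) ∂μ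
      ≤ ∫ ω, P (X.state t ω) * max (G (X.state t ω) (X.θ t ω) - m (X.state t ω)) 0 ∂μ := by
    rw [e1.2]
    refine integral_mono i0 (X.integrable_state t fun s =>
      ∫ θ, P s * max (G s θ - m s) 0 ∂(sampleLaw R)) fun ω => ?_
    simp only
    rw [integral_const_mul]
    exact utility_sub_meanSampledValue_le hβ hr hu hc hq (hv t ω) (hs t ω) hS
  have h1 : ∫ ω, (V - utility r c u q (X.seq t ω)) ∂μ
      = ∫ ω, (V - m (X.state t ω)) ∂μ
        + ∫ ω, (G (X.state t ω) (X.θ t ω) - utility r c u q (X.seq t ω)) ∂μ := by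
    have : ∫ ω, (V - utility r c u q (X.seq t ω)) ∂μ
        = ∫ ω, (((V - m (X.state t ω)) + (m (X.state t ω) - G (X.state t ω) (X.θ t ω)))
          + (G (X.state t ω) (X.θ t ω) - utility r c u q (X.seq t ω))) ∂μ :=
      integral_congr_ae (Filter.Eventually.of_forall fun ω => by simp)
    have i01 : Integrable (fun ω => (V - m (X.state t ω))
        + (m (X.state t ω) - G (X.state t ω) (X.θ t ω))) μ := i0.add e2.1
    rw [this, integral_add i01 i1, integral_add i0 e2.1, e2', add_zero]
  have iV := X.integrable_state_seq t (viewCost u q)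
  have h2 : ∫ ω, (P (X.state t ω) * max (G (X.state t ω) (X.θ t ω) - m (X.state t ω)) 0
        + (G (X.state t ω) (X.θ t ω) - utility r c u q (X.seq t ω))) ∂μ
      ≤ ∫ ω, (δ ^ 2 * (2 * N) * regretFactor α β u q (X.state t ω) (X.θ t ω) ^ 3
        + 8 * δ⁻¹ * viewCost u q (X.state t ω) (X.seq t ω)) ∂μ := by
    refine integral_mono (e1.1.add i1) ((e3.1.const_mul _).add (iV.const_mul _)) fun ω => ?_
    exact (optimismFactor_mul_add_le hα.le (by linarith) hr hu hc hq (hv t ω) (hs t ω)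
      (X.optimal t ω)).trans (X.regretFactor_mul_viewWidth_le hu hq hδ t ω)
  rw [integral_add e1.1 i1, integral_add (e3.1.const_mul _) (iV.const_mul _),
    integral_const_mul, integral_const_mul, e3.2] at h2
  have h3 : ∫ ω, (∫ θ, regretFactor α β u q (X.state t ω) θ ^ 3 ∂(sampleLaw R)) ∂μ
      ≤ momentConst α β * sampleScale R ^ 3 * ∫ ω, devWeight u q (X.state t ω) ∂μ := by
    rw [← integral_const_mul]
    exact integral_mono (X.integrable_state t fun s =>
        ∫ θ : Fin R → ℝ, regretFactor α β u q s θ ^ 3 ∂(sampleLaw R))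
      ((X.integrable_state t (devWeight u q)).const_mul _)
      fun ω => (integral_regretFactor_pow_three_le α β u q _).2
  have h4 := mul_le_mul_of_nonneg_left h3 (by positivity : 0 ≤ δ ^ 2 * (2 * (N : ℝ)))
  linarith

lemma integrable_regret_round (Sopt : List (Fin N)) (t : ℕ) :
    Integrable (fun ω => utility r c u q Sopt - utility r c u q (X.seq t ω)) μ :=
  X.integrable_state_seq t fun _ S => utility r c u q Sopt - utility r c u q S

lemma regret_eq_sum (Sopt : List (Fin N)) (T : ℕ) :
    X.regret Sopt T = ∑ t ∈ Finset.range T,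
      ∫ ω, (utility r c u q Sopt - utility r c u q (X.seq t ω)) ∂μ :=
  integral_finsetSum _ fun t _ => X.integrable_regret_round Sopt t

lemma regret_le_two_mul (hr : ∀ i, r i ∈ Set.Icc (0 : ℝ) 1)
    (hu : ∀ i, u i ∈ Set.Icc (0 : ℝ) 1) (hc : c ∈ Set.Icc (0 : ℝ) 1)
    (hq : q ∈ Set.Icc (0 : ℝ) 1) (Sopt : List (Fin N)) (T : ℕ) :
    X.regret Sopt T ≤ 2 * T := by
  rw [X.regret_eq_sum]
  refine (Finset.sum_le_card_nsmul _ _ 2 fun t _ => ?_).trans_eq (by simp [mul_comm])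
  refine (integral_mono (X.integrable_regret_round Sopt t) (integrable_const (2 : ℝ))
    fun ω => ?_).trans_eq (by simp)
  have h1 := (utility_mem_Icc hr hc hu hq Sopt).2
  have h2 := (utility_mem_Icc hr hc hu hq (X.seq t ω)).1
  simp only
  linarith [hc.2]

/-! ### The regret over all rounds -/

lemma integral_devWeight_le_log (hu : ∀ i, u i ∈ Set.Icc (0 : ℝ) 1)
    (hq : q ∈ Set.Icc (0 : ℝ) 1) (hN : 1 ≤ N) {T : ℕ} (hT : 2 ≤ T) {t : ℕ} (ht : t ≤ T) :
    ∫ ω, devWeight u q (X.state t ω) ∂μ ≤ 96 * (N ^ 2 + N * Real.log T) := by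
  have hN' : (1 : ℝ) ≤ N := by exact_mod_cast hN
  have hT' : (2 : ℝ) ≤ T := by exact_mod_cast hT
  set K := ⌈Real.log (N * T + 2)⌉₊ with hK
  have hpos : (0 : ℝ) < N * T + 2 := by positivity
  have hlog0 : 0 ≤ Real.log (N * T + 2) := Real.log_nonneg (by nlinarith)
  have h1 : N * t + 2 ≤ 4 ^ K := by
    have a1 : (N * T + 2 : ℝ) ≤ 4 ^ K := by
      calc (N * T + 2 : ℝ) = Real.exp (Real.log (N * T + 2)) := (Real.exp_log hpos).symm
        _ ≤ Real.exp K := Real.exp_le_exp.2 (Nat.le_ceil _)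
        _ = Real.exp 1 ^ K := by rw [← Real.exp_nat_mul, mul_one]
        _ ≤ 4 ^ K := by
          gcongr
          linarith [Real.exp_one_lt_d9]
    have a2 : N * T + 2 ≤ 4 ^ K := by exact_mod_cast a1
    exact (Nat.add_le_add_right (Nat.mul_le_mul_left N ht) 2).trans a2
  have h2 : (K : ℝ) ≤ N + 1 + Real.log T := by
    have b1 : (K : ℝ) < Real.log (N * T + 2) + 1 := Nat.ceil_lt_add_one hlog0
    have b2 : Real.log (N * T + 2) ≤ Real.log (2 * N * T) :=
      Real.log_le_log hpos (by nlinarith)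
    rw [Real.log_mul (by positivity) (by positivity), Real.log_mul (by norm_num) (by positivity)]
      at b2
    -- Bounding `log N` by `N - 1` is crude but harmless, since the final rate contains `N²` anyway.
    have b3 := Real.log_le_sub_one_of_pos (x := (N : ℝ)) (by positivity)
    linarith [Real.log_two_lt_d9]
  have h3 : Real.exp 2 ≤ 8 := by
    have : Real.exp 2 = Real.exp 1 ^ 2 := by rw [← Real.exp_nat_mul]; norm_num
    rw [this]
    nlinarith [Real.exp_one_lt_d9, Real.exp_pos 1]
  have h4 : Real.exp (3 / 2) ≤ 8 := (Real.exp_le_exp.2 (by norm_num)).trans h3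
  have hl : 0 ≤ Real.log T := Real.log_nonneg (by linarith)
  calc _ ≤ (N + 1) * (Real.exp (3 / 2) + K * (2 * Real.exp 2)) :=
        X.integral_devWeight_le hu hq hN t h1
    _ ≤ (N + N) * (8 + (N + 1 + Real.log T) * (2 * 8)) := by gcongr
    _ ≤ _ := by nlinarith

lemma regret_le [NeZero R] (hα : 0 < α) (hβ : 2 ≤ β) (hr : ∀ i, r i ∈ Set.Icc (0 : ℝ) 1)
    (hu : ∀ i, u i ∈ Set.Icc (0 : ℝ) 1) (hc : c ∈ Set.Icc (0 : ℝ) 1)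
    (hq : q ∈ Set.Icc (0 : ℝ) 1) {Sopt : List (Fin N)} (hS : Sopt.Nodup) (hN : 1 ≤ N) {T : ℕ}
    (hT : 2 ≤ T) :
    X.regret Sopt T ≤ (384 * momentConst α β + 32) * N * (N + √(Real.log T)) * √T
      * sampleScale R := by
  have hN' : (1 : ℝ) ≤ N := by exact_mod_cast hN
  have hT' : (2 : ℝ) ≤ T := by exact_mod_cast hT
  set L := sampleScale R
  set b := √(Real.log T)
  set v := root4 (T : ℝ)
  set M := momentConst α β
  have hM : 0 < M := momentConst_pos α β
  have hL : 0 < L := zero_lt_one.trans_le (one_le_sampleScale NeZero.one_le)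
  have hv : 0 < v := root4_pos (by linarith)
  have hb0 : 0 ≤ b := Real.sqrt_nonneg _
  have hb2 : b ^ 2 = Real.log T := Real.sq_sqrt (Real.log_nonneg (by linarith))
  have hv2 : v ^ 2 = √T := root4_sq _
  have hv4 : v ^ 4 = T := root4_pow_four (by linarith)
  have hNb : 0 < N + b := by linarith
  -- This choice balances the terms: `T δ² N L³ (N + b)³` and `δ⁻¹ N v` are both of order `N (N + b)
  -- √T L`, where `v² = √T`.
  set δ := (v * L * (N + b))⁻¹ with hδ
  have hδ0 : 0 < δ := by positivity
  have h1 (t : ℕ) (ht : t ∈ Finset.range T) :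
      ∫ ω, (utility r c u q Sopt - utility r c u q (X.seq t ω)) ∂μ
        ≤ δ ^ 2 * (2 * N) * (M * L ^ 3 * (96 * (N ^ 2 + N * b ^ 2)))
          + 8 * δ⁻¹ * ∫ ω, viewCost u q (X.state t ω) (X.seq t ω) ∂μ := by
    refine (X.integral_regret_round_le hα hβ hr hu hc hq hS hδ0 t).trans ?_
    have := X.integral_devWeight_le_log hu hq hN hT (Finset.mem_range.1 ht).le
    rw [hb2]
    gcongr
  rw [X.regret_eq_sum]
  refine (Finset.sum_le_sum h1).trans ?_
  rw [Finset.sum_add_distrib, Finset.sum_const, Finset.card_range, nsmul_eq_mul,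
    ← Finset.mul_sum]
  have h2 := X.sum_integral_viewCost_le hu hq hN hT
  have h3 : (N : ℝ) ^ 2 + N * b ^ 2 ≤ 2 * (N + b) ^ 3 := by
    have c1 : (N : ℝ) ^ 2 ≤ (N + b) ^ 3 := by
      calc (N : ℝ) ^ 2 ≤ (N + b) ^ 2 := by gcongr; linarith
        _ ≤ (N + b) ^ 3 := pow_le_pow_right₀ (by linarith) (by norm_num)
    have c2 : (N : ℝ) * b ^ 2 ≤ (N + b) ^ 3 := by
      calc (N : ℝ) * b ^ 2 ≤ (N + b) * (N + b) ^ 2 := by gcongr <;> linarith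
        _ = _ := by ring
    linarith
  calc _ ≤ T * (δ ^ 2 * (2 * N) * (M * L ^ 3 * (96 * (2 * (N + b) ^ 3))))
        + 8 * δ⁻¹ * (4 * N * v) := by gcongr
    _ = _ := by
      rw [← hv2, ← hv4, hδ]
      field_simp
      ring

end Run

end

end SBORS

/-! ### Passage to the stated form of the bound, and the degenerate cases. -/

namespace SBORS

lemma sampleScale_le {R T : ℕ} (hR : 1 ≤ R) (hT : 2 ≤ T) :
    sampleScale R ≤ 2 * √(Real.log ((T : ℝ) * R)) := by
  have hR' : (1 : ℝ) ≤ R := by exact_mod_cast hR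
  have hT' : (2 : ℝ) ≤ T := by exact_mod_cast hT
  have h1 : Real.log (2 * R) ≤ Real.log (T * R) :=
    Real.log_le_log (by linarith) (by gcongr)
  have h2 : 0 ≤ Real.log (2 * R) := Real.log_nonneg (by linarith)
  calc sampleScale R ≤ √(2 ^ 2 * Real.log (T * R)) := Real.sqrt_le_sqrt (by linarith)
    _ = _ := by rw [Real.sqrt_mul (by norm_num), Real.sqrt_sq (by norm_num)]

end SBORS

theorem theorem2 (α β : ℝ) (hα : 0 < α) (hβ : 2 ≤ β) :
    ∃ C₁ C₂ C₃ : ℝ, 0 < C₁ ∧ 0 < C₂ ∧ 0 < C₃ ∧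
      ∀ (N R T : ℕ), 1 ≤ R →
      ∀ (r u : Fin N → ℝ) (c q : ℝ),
        (∀ i, r i ∈ Set.Icc (0 : ℝ) 1) → (∀ i, u i ∈ Set.Icc (0 : ℝ) 1) →
        c ∈ Set.Icc (0 : ℝ) 1 → q ∈ Set.Icc (0 : ℝ) 1 →
      ∀ (Ω : Type*) [MeasurableSpace Ω] (μ : MeasureTheory.Measure Ω)
        [MeasureTheory.IsProbabilityMeasure μ] (X : SBORS.Run α β R r c u q μ)
        (Sopt : List (Fin N)), SBORS.IsOptimal r c u q Sopt →
        X.regret Sopt T ≤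
          C₁ * (N : ℝ) ^ 2 * √((N : ℝ) * (T : ℝ) * Real.log ((T : ℝ) * (R : ℝ)))
            + C₂ * (N : ℝ) * √((T : ℝ) * Real.log ((T : ℝ) * (R : ℝ)) * Real.log (T : ℝ))
            + C₃ * (N : ℝ) / (R : ℝ) := by
  set M := SBORS.momentConst α β
  have hM0 : 0 < M := SBORS.momentConst_pos α β
  refine ⟨2 * (384 * M + 32), 2 * (384 * M + 32), 2, by positivity, by positivity, by norm_num, ?_⟩
  intro N R T hR r u c q hr hu hc hq Ω _ μ _ X Sopt hS
  have hR' : (1 : ℝ) ≤ R := by exact_mod_cast hR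
  rcases Nat.eq_zero_or_pos N with rfl | hN
  · have hnil (S : List (Fin 0)) : S = [] := by
      cases S with
      | nil => rfl
      | cons i _ => exact i.elim0
    have h : X.regret Sopt T = 0 := by
      simp [X.regret_eq_sum, hnil Sopt, hnil (X.seq _ _)]
    simp [h]
  have hN' : (1 : ℝ) ≤ N := by exact_mod_cast hN
  -- The general bound uses `T ≥ 2`; for fewer rounds the regret is at most `2 T`.
  rcases lt_or_ge T 2 with hT | hT
  · have h1 := X.regret_le_two_mul hr hu hc hq Sopt T
    have h2 : 0 ≤ 2 * (384 * M + 32) * (N : ℝ)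
        * √((T : ℝ) * Real.log ((T : ℝ) * R) * Real.log T) := by positivity
    have h3 : 0 ≤ 2 * (384 * M + 32) * (N : ℝ) ^ 2
        * √((N : ℝ) * T * Real.log ((T : ℝ) * R)) := by positivity
    have h4 : 0 ≤ 2 * (N : ℝ) / R := by positivity
    interval_cases T
    · simp only [Nat.cast_zero, mul_zero] at h1
      exact h1.trans (add_nonneg (add_nonneg h3 h2) h4)
    · simp only [Nat.cast_one, mul_one, one_mul] at h1 h2 h3 ⊢
      -- For `T = R = 1` both logarithmic terms vanish and only `C₃ N / R ≥ 2` is left. For `R ≥ 2`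
      -- the first term already exceeds `2`.
      rcases hR.eq_or_lt with rfl | hR2
      · simp only [Nat.cast_one, div_one] at h2 h3 ⊢
        linarith
      · have hR2' : (2 : ℝ) ≤ R := by exact_mod_cast hR2
        have hlog : 1 / 4 ≤ (N : ℝ) * Real.log R := by
          have h5 : Real.log 2 ≤ Real.log R := Real.log_le_log (by norm_num) hR2'
          nlinarith [Real.log_two_gt_d9]
        have h6 : 1 / 2 ≤ √((N : ℝ) * Real.log R) :=
          Real.le_sqrt_of_sq_le (by linarith)
        have h7 : (1 : ℝ) ≤ (N : ℝ) ^ 2 := one_le_pow₀ hN'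
        have h8 : 2 * (384 * M + 32) * 1 * (1 / 2)
            ≤ 2 * (384 * M + 32) * (N : ℝ) ^ 2 * √((N : ℝ) * Real.log R) := by gcongr
        linarith
  · have : NeZero R := ⟨by omega⟩
    have hT' : (2 : ℝ) ≤ T := by exact_mod_cast hT
    have h1 := X.regret_le hα hβ hr hu hc hq hS.1 hN hT
    have h2 := SBORS.sampleScale_le hR hT
    set l := Real.log ((T : ℝ) * R)
    have hl : 0 ≤ l := Real.log_nonneg (by nlinarith)
    have hlT : 0 ≤ Real.log T := Real.log_nonneg (by linarith)
    have e1 : √((T : ℝ) * l * Real.log T) = √T * √l * √(Real.log T) := by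
      rw [Real.sqrt_mul (by positivity), Real.sqrt_mul (by positivity)]
    -- The factor `√N` of the statement is given away here.
    have e2 : √T * √l ≤ √((N : ℝ) * T * l) := by
      rw [← Real.sqrt_mul (by positivity)]
      refine Real.sqrt_le_sqrt ?_
      rw [mul_assoc]
      exact le_mul_of_one_le_left (by positivity) hN'
    have h3 : 0 ≤ 2 * (N : ℝ) / R := by positivity
    calc X.regret Sopt T ≤ _ := h1
      _ ≤ (384 * M + 32) * N * (N + √(Real.log T)) * √T * (2 * √l) := by gcongr
      _ = 2 * (384 * M + 32) * (N : ℝ) ^ 2 * (√T * √l)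
          + 2 * (384 * M + 32) * N * (√T * √l * √(Real.log T)) := by ring
      _ ≤ 2 * (384 * M + 32) * (N : ℝ) ^ 2 * √((N : ℝ) * T * l)
          + 2 * (384 * M + 32) * N * √((T : ℝ) * l * Real.log T) := by
          rw [e1]
          gcongr
      _ ≤ _ := by linarith
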